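/- Let $k\ge 1$ and $0<m_1<\dots<m_k<1$. For $\alpha=(n_1,\dots,n_k)\in\mathbb N^k$ write $\alpha^l=(n_1,\dots,n_l)$. *Cascade.* For every $1\le l\le k$ and $a\in\mathbb N^{l-1}$ let $(u_{(a,n)})_{n\ge1}$ be a decreasing enumeration of a Poisson point process on $(0,\infty)$ with intensity measure $x^{-1-m_l}\,dx$, all these processes being independent, and let $v_\alpha=\prod_{1\le l\le k}u_{\alpha^l}$. *Labels.* Let $\mathcal X_1,\dots,\mathcal X_k$ be complete separable metric spaces with their Borel $\sigma$-algebras, let $\mathcal X^l=\mathcal X_1\times\dots\times\mathcal X_l$, and let $\nu_l(\cdot\mid x)$, for $x\in\mathcal X^{l-1}$, be a probability kernel from $\mathcal X^{l-1}$ to $\mathcal X_l$ ($1\le l\le k$; $\nu_1$ is a probability measure on $\mathcal X_1$). Independently of the cascade, generate labels $z_{\alpha^l}\in\mathcal X_l$ recursively in $l$: given all labels on the levels before $l$, the labels on level $l$ are independent and $z_{\alpha^l}$ has distribution $\nu_l(\cdot\mid Z_{\alpha^{l-1}})$, where $Z_{\alpha^{l}}=(z_{\alpha^1},\dots,z_{\alpha^l})$.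 Put $Z_\alpha=Z_{\alpha^k}$. *Reweighting.* Let $X,Y:\mathcal X^k\to\mathbb R$ be measurable with $\mathbb E\exp X(Z_\alpha)<\infty$ and $\mathbb E\,Y(Z_\alpha)^2<\infty$, and let $X_\alpha=X(Z_\alpha)$, $Y_\alpha=Y(Z_\alpha)$. For $l=k,k-1,\dots,1$ define functions of $Z_{\alpha^{l-1}}$ and $Z_{\alpha^l}$ by $$X_{\alpha^{l-1}}=\frac1{m_l}\log\mathbb E_l\exp (m_lX_{\alpha^l}),\qquad W_{\alpha^l}=W_l(Z_{\alpha^{l-1}},z_{\alpha^l})=\exp m_l(X_{\alpha^l}-X_{\alpha^{l-1}}),$$ where $\mathbb E_l$ is the expectation in $z_{\alpha^l}$ with respect to $\nu_l(\cdot\mid Z_{\alpha^{l-1}})$. Let $(Z'_\alpha)$ be a process generated in the same way as $(Z_\alpha)$, but with the conditional distributions $W_l(x,y)\,d\nu_l(y\mid x)$ in place of $\nu_l(\cdot\mid x)$. Then, almost surely, $0<\sum_\alpha v_\alpha e^{X_\alpha}<\infty$, and for every fixed $\alpha_0\in\mathbb N^k$: 1. In $[0,\infty]$, $$\mathbb E\,\frac{\sum_\alpha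 v_\alpha e^{X_\alpha}|Y_\alpha|}{\sum_\alpha v_\alpha e^{X_\alpha}}=\mathbb E\Big[\prod_{1\le l\le k}W_{\alpha_0^l}\,|Y_{\alpha_0}|\Big]=\mathbb E\,|Y(Z'_{\alpha_0})| .$$ 2. If this common value is finite, that is, if $\prod_{1\le l\le k} W_{\alpha_0^l}\,Y_{\alpha_0}$ is integrable, then almost surely $\sum_\alpha v_\alpha e^{X_\alpha}Y_\alpha$ converges absolutely, the Gibbs average below and $Y(Z'_{\alpha_0})$ are integrable, and $$\mathbb E\,\frac{\sum_\alpha v_\alpha e^{X_\alpha}\,Y_\alpha}{\sum_\alpha v_\alpha e^{X_\alpha}}=\mathbb E\Big[\prod_{1\le l\le k}W_{\alpha_0^l}\,Y_{\alpha_0}\Big]=\mathbb E\,Y(Z'_{\alpha_0}) .$$ -/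

import Mathlib

open MeasureTheory ProbabilityTheory

namespace RuelleCascade

/-- The intensity measure `x ^ (-1 - m) dx` on `(0, ∞)`, seen as a measure on `ℝ`. -/
noncomputable def intensity (m : ℝ) : Measure ℝ :=
  (volume.restrict (Set.Ioi (0 : ℝ))).withDensity fun x => ENNReal.ofReal (x ^ (-1 - m))

/-- The number of points of the sequence `(u n ω)_n` that lie in `A`, counted with multiplicity. -/
noncomputable def pointCount {Ω : Type*} (u : ℕ → Ω → ℝ) (A : Set ℝ) (ω : Ω) : ℕ∞ :=
  {n | u n ω ∈ A}.encard

/-- `(u n)_n` is a decreasing enumeration of a Poisson point process on `(0, ∞)` with intensity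
measure `x ^ (-1 - m) dx`: the number of points in a Borel set `A` is Poisson distributed with mean
the intensity of `A` (it is almost surely infinite if this mean is infinite), and the numbers of
points in pairwise disjoint Borel sets are independent. -/
structure IsPoissonEnumeration {Ω : Type*} [MeasurableSpace Ω] (P : Measure Ω) (m : ℝ)
    (u : ℕ → Ω → ℝ) : Prop where
  measurable : ∀ n, Measurable (u n)
  pos : ∀ᵐ ω ∂P, ∀ n, 0 < u n ω
  antitone : ∀ᵐ ω ∂P, Antitone fun n => u n ω
  law_of_ne_top : ∀ A : Set ℝ, MeasurableSet A → intensity m A ≠ ⊤ →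
    HasLaw (pointCount u A)
      ((poissonMeasure (intensity m A).toNNReal).map (fun n : ℕ => (n : ℕ∞))) P
  law_of_eq_top : ∀ A : Set ℝ, MeasurableSet A → intensity m A = ⊤ →
    ∀ᵐ ω ∂P, pointCount u A ω = ⊤
  indep : ∀ (N : ℕ) (A : Fin N → Set ℝ), (∀ i, MeasurableSet (A i)) →
    Pairwise (fun i j => Disjoint (A i) (A j)) → iIndepFun (fun i => pointCount u (A i)) P

/-- The family of Poisson processes of a Derrida-Ruelle cascade. Levels are numbered from `0` to
`k - 1`; `u l a n` is the `n`-th point of the process attached to the node `a ∈ ℕ ^ l`, that is,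
`u_{a_1 … a_l n}`. The process attached to `a` has intensity `x ^ (-1 - m l) dx`, and the processes
attached to all the nodes of all the levels are independent. -/
structure IsCascade {k : ℕ} {Ω : Type*} [MeasurableSpace Ω] (P : Measure Ω) (m : Fin k → ℝ)
    (u : (l : Fin k) → (Fin l → ℕ) → ℕ → Ω → ℝ) : Prop where
  poisson : ∀ (l : Fin k) (a : Fin l → ℕ), IsPoissonEnumeration P (m l) (u l a)
  indep : iIndepFun
    (fun (p : Σ l : Fin k, (Fin l → ℕ)) (ω : Ω) (n : ℕ) => u p.1 p.2 n ω) P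

/-- The product of the first `l` of the spaces `𝒳 0, …, 𝒳 (k - 1)`. -/
abbrev Prefix {k : ℕ} (𝒳 : Fin k → Type*) (l : Fin (k + 1)) : Type _ :=
  (i : Fin l) → 𝒳 (i.castLE (Nat.le_of_lt_succ l.isLt))

/-- The point `(x, y)` of the product of the first `l + 1` spaces. -/
def append {k : ℕ} {𝒳 : Fin k → Type*} (l : Fin k) (x : Prefix 𝒳 l.castSucc) (y : 𝒳 l) :
    Prefix 𝒳 l.succ :=
  Fin.snoc (α := fun i : Fin (l + 1) => 𝒳 (i.castLE l.isLt)) x y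

/-- The node `α ^ l`, made of the first `l` indices of `α`. -/
def trunc {k : ℕ} (α : Fin k → ℕ) (l : Fin (k + 1)) : Fin l → ℕ :=
  fun i => α (i.castLE (Nat.le_of_lt_succ l.isLt))

/-- The weight `v_α`, the product of the points of the cascade along the branch `α`. -/
def weight {k : ℕ} {Ω : Type*} (u : (l : Fin k) → (Fin l → ℕ) → ℕ → Ω → ℝ)
    (α : Fin k → ℕ) (ω : Ω) : ℝ :=
  ∏ l : Fin k, u l (trunc α l.castSucc) (α l) ω

/-- The labels on the way from the root to the node `a ∈ ℕ ^ l`, that is,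
`(z_{a_1}, z_{a_1 a_2}, …, z_{a_1 … a_l})`. Here `z l a n` stands for `z_{a_1 … a_l n}`. -/
def labels {k : ℕ} {𝒳 : Fin k → Type*} {Ω : Type*}
    (z : (l : Fin k) → (Fin l → ℕ) → ℕ → Ω → 𝒳 l) (l : Fin (k + 1)) (a : Fin l → ℕ) (ω : Ω) :
    Prefix 𝒳 l :=
  fun i => z (i.castLE (Nat.le_of_lt_succ l.isLt)) (fun j => a (j.castLE i.isLt.le)) (a i) ω

/-- The `σ`-algebra generated by all the labels on the levels before level `l`. -/
@[reducible] def history {k : ℕ} {𝒳 : Fin k → Type*} [∀ l, MeasurableSpace (𝒳 l)] {Ω : Type*}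
    (z : (l : Fin k) → (Fin l → ℕ) → ℕ → Ω → 𝒳 l) (l : Fin k) : MeasurableSpace Ω :=
  ⨆ (j : Fin k) (_ : j < l) (a : Fin j → ℕ) (n : ℕ), MeasurableSpace.comap (z j a n) inferInstance

/-- The labels `z` are generated recursively from the conditional distributions `ν l`: given all the
labels on the levels before level `l`, the labels `z l a n` on level `l` are independent and
`z l a n` has distribution `ν l (labels of a)`. -/
structure IsTreeProcess {k : ℕ} {𝒳 : Fin k → Type*} [∀ l, MeasurableSpace (𝒳 l)] {Ω : Type*}
    [MeasurableSpace Ω] (P : Measure Ω) (ν : (l : Fin k) → Prefix 𝒳 l.castSucc → Measure (𝒳 l))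
    (z : (l : Fin k) → (Fin l → ℕ) → ℕ → Ω → 𝒳 l) : Prop where
  measurable : ∀ l a n, Measurable (z l a n)
  cond_law : ∀ (l : Fin k) (S : Finset ((Fin l → ℕ) × ℕ)) (B : (Fin l → ℕ) × ℕ → Set (𝒳 l)),
    (∀ p, MeasurableSet (B p)) → ∀ A : Set Ω, MeasurableSet[history z l] A →
      P (A ∩ ⋂ p ∈ S, z l p.1 p.2 ⁻¹' B p) =
        ∫⁻ ω in A, ∏ p ∈ S, ν l (labels z l.castSucc p.1 ω) (B p) ∂P

/-- The functions `X_l` on the product of the first `l` spaces, defined by backward recursion: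
`X_k = X` and `X_{l} = (1 / m) log E exp (m X_{l + 1})`, where `m` is the parameter of the step from
`l` to `l + 1` and the expectation is over the last coordinate, distributed according to `ν l`. -/
noncomputable def level {k : ℕ} {𝒳 : Fin k → Type*} [∀ l, MeasurableSpace (𝒳 l)] (m : Fin k → ℝ)
    (ν : (l : Fin k) → Prefix 𝒳 l.castSucc → Measure (𝒳 l)) (X : Prefix 𝒳 (Fin.last k) → ℝ)
    (l : Fin (k + 1)) : Prefix 𝒳 l → ℝ :=
  Fin.reverseInduction (motive := fun l => Prefix 𝒳 l → ℝ) X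
    (fun l F x => 1 / m l * Real.log (∫ y, Real.exp (m l * F (append l x y)) ∂(ν l x))) l

theorem level_last {k : ℕ} {𝒳 : Fin k → Type*} [∀ l, MeasurableSpace (𝒳 l)] (m : Fin k → ℝ)
    (ν : (l : Fin k) → Prefix 𝒳 l.castSucc → Measure (𝒳 l)) (X : Prefix 𝒳 (Fin.last k) → ℝ) :
    level m ν X (Fin.last k) = X := by
  simp [level]

theorem level_castSucc {k : ℕ} {𝒳 : Fin k → Type*} [∀ l, MeasurableSpace (𝒳 l)] (m : Fin k → ℝ)
    (ν : (l : Fin k) → Prefix 𝒳 l.castSucc → Measure (𝒳 l)) (X : Prefix 𝒳 (Fin.last k) → ℝ)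
    (l : Fin k) (x : Prefix 𝒳 l.castSucc) :
    level m ν X l.castSucc x =
      1 / m l * Real.log (∫ y, Real.exp (m l * level m ν X l.succ (append l x y)) ∂(ν l x)) := by
  simp [level]

/-- The function `W (x, y) = exp (m (X_{l + 1} (x, y) - X_l x))` of the step from `l` to `l + 1`. -/
noncomputable def stepDensity {k : ℕ} {𝒳 : Fin k → Type*} [∀ l, MeasurableSpace (𝒳 l)]
    (m : Fin k → ℝ) (ν : (l : Fin k) → Prefix 𝒳 l.castSucc → Measure (𝒳 l))
    (X : Prefix 𝒳 (Fin.last k) → ℝ) (l : Fin k) (x : Prefix 𝒳 l.castSucc) (y : 𝒳 l) : ℝ :=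
  Real.exp (m l * (level m ν X l.succ (append l x y) - level m ν X l.castSucc x))

/-- The conditional distributions `W (x, y) dν(y | x)` of the reweighted law. -/
noncomputable def reweighted {k : ℕ} {𝒳 : Fin k → Type*} [∀ l, MeasurableSpace (𝒳 l)]
    (m : Fin k → ℝ) (ν : (l : Fin k) → Prefix 𝒳 l.castSucc → Measure (𝒳 l))
    (X : Prefix 𝒳 (Fin.last k) → ℝ) (l : Fin k) (x : Prefix 𝒳 l.castSucc) : Measure (𝒳 l) :=
  (ν l x).withDensity fun y => ENNReal.ofReal (stepDensity m ν X l x y)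

/-- The point `Z_α` of the product of all the spaces. -/
def branch {k : ℕ} {𝒳 : Fin k → Type*} {Ω : Type*}
    (z : (l : Fin k) → (Fin l → ℕ) → ℕ → Ω → 𝒳 l) (α : Fin k → ℕ) (ω : Ω) :
    Prefix 𝒳 (Fin.last k) :=
  labels z (Fin.last k) (trunc α (Fin.last k)) ω

/-- The product of the `W`'s along the branch `α`. -/
noncomputable def branchDensity {k : ℕ} {𝒳 : Fin k → Type*} [∀ l, MeasurableSpace (𝒳 l)]
    {Ω : Type*} (m : Fin k → ℝ) (ν : (l : Fin k) → Prefix 𝒳 l.castSucc → Measure (𝒳 l))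
    (X : Prefix 𝒳 (Fin.last k) → ℝ) (z : (l : Fin k) → (Fin l → ℕ) → ℕ → Ω → 𝒳 l)
    (α : Fin k → ℕ) (ω : Ω) : ℝ :=
  ∏ l : Fin k, stepDensity m ν X l (labels z l.castSucc (trunc α l.castSucc) ω)
    (z l (trunc α l.castSucc) (α l) ω)

end RuelleCascade

open RuelleCascade

/-! The law of a sum over the cascade depends on the weights at the leaves only through one number,
and this is visible in Laplace transforms. Let `u_n` be a Poisson process with intensity `x^(-1-m)
dx`. Give its points conditionally independent marks, each with a label-dependent transform `exp(-K
(c N)^p)`, where `m < p`. Since the intensity is homogeneous, the weighted sum of the marks has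
transform `exp(-C s^m E N^m)` at `s`, and `C` is finite exactly because `m < p`. Iterating from the
leaves to the root, with exponents `1 > m_k > ... > m_1`, gives `E exp(-s S_w) = exp(-K (s
N_0(w))^θ)` for `S_w = ∑ v_α w(Z_α)`. Here `N_0` is the root value of the recursion `N_l = (E_{l+1}
N_{l+1}^m)^(1/m)`, and `K`, `θ` do not depend on `w` (`exists_lintegral_prod_expNeg_subtreeSum`,
`exists_lintegral_expNeg_totalSum`). For `w = exp X` one has `N_l = exp X_l` almost surely along the
tree.

Perturb `w` to `w (1 + r f)` with `0 ≤ f ≤ 1`, and let `D` be the reweighted expectation of `f`.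
Jensen's inequality for the probability measures `W dν` on each level yields `N_0(w (1 + r f)) ≤ (1
+ r D) N_0(w)` (`IsTreeProcess.nestedNorm_mul_le`). With `S = S_w` and `T = S_{w f}`, this means `E
exp(-s (1 + r D) S) ≤ E exp(-s (S + r T))`. Comparing first orders in `r` and integrating over `s`
gives `E (T / S) ≤ D` (`lintegral_div_le_of_lintegral_expNeg_le`).

No reverse inequality has to be proved. For indicators `f` the bound says that the averaged Gibbs
law of the labels is dominated by the reweighted law of a branch. Both are probability measures, so
they coincide (`lintegral_gibbs`). This is the identity in `[0, ∞]` for every nonnegative function;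
the signed case follows from positive and negative parts. -/

namespace RuelleCascade
open Filter Topology
open scoped ENNReal NNReal

/-! ### Exponentials on `[0, ∞]` and the Laplace functional of a Poisson process. -/

section

/-- The function `x ↦ exp (-x)` on `[0, ∞]`. -/
noncomputable def expNeg (x : ℝ≥0∞) : ℝ≥0∞ := EReal.exp (-(x : EReal))

@[simp] lemma expNeg_zero : expNeg 0 = 1 := by simp [expNeg]

@[simp] lemma expNeg_top : expNeg ∞ = 0 := by simp [expNeg]

lemma expNeg_ofReal {x : ℝ} (hx : 0 ≤ x) :
    expNeg (ENNReal.ofReal x) = ENNReal.ofReal (Real.exp (-x)) := by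
  rw [expNeg, EReal.coe_ennreal_ofReal, max_eq_left hx, ← EReal.coe_neg, EReal.exp_coe]

lemma expNeg_antitone : Antitone expNeg := fun x y h => by
  simpa [expNeg, EReal.neg_le_neg_iff] using h

lemma expNeg_le_one (x : ℝ≥0∞) : expNeg x ≤ 1 := by
  simpa [expNeg] using EReal.coe_ennreal_nonneg x

lemma expNeg_ne_top (x : ℝ≥0∞) : expNeg x ≠ ∞ := ((expNeg_le_one x).trans_lt ENNReal.one_lt_top).ne

lemma expNeg_lt_one {x : ℝ≥0∞} (hx : x ≠ 0) : expNeg x < 1 := by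
  simpa [expNeg, pos_iff_ne_zero] using hx

lemma expNeg_continuous : Continuous expNeg :=
  ENNReal.continuous_exp.comp (continuous_neg.comp continuous_coe_ennreal_ereal)

lemma expNeg_measurable : Measurable expNeg := expNeg_continuous.measurable

@[fun_prop] lemma Measurable.expNeg {α : Type*} {_ : MeasurableSpace α} {f : α → ℝ≥0∞}
    (hf : Measurable f) : Measurable fun x => expNeg (f x) := expNeg_measurable.comp hf

lemma expNeg_add (x y : ℝ≥0∞) : expNeg (x + y) = expNeg x * expNeg y := by
  rw [expNeg, EReal.coe_ennreal_add, EReal.neg_add (by simp) (by simp), sub_eq_add_neg,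
    EReal.exp_add, expNeg, expNeg]

lemma expNeg_sum {ι : Type*} (s : Finset ι) (f : ι → ℝ≥0∞) :
    expNeg (∑ i ∈ s, f i) = ∏ i ∈ s, expNeg (f i) := by
  classical
  induction s using Finset.induction_on with
  | empty => simp
  | insert a s ha ih => rw [Finset.sum_insert ha, Finset.prod_insert ha, expNeg_add, ih]

lemma one_sub_expNeg_le (x : ℝ≥0∞) : 1 - expNeg x ≤ x := by
  by_cases h : x = ∞
  · simp [h]
  · lift x to ℝ≥0 using h
    have := expNeg_ofReal x.2
    simp only [NNReal.val_eq_coe, ENNReal.ofReal_coe_nnreal] at this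
    rw [this, ← ENNReal.ofReal_one, ← ENNReal.ofReal_sub _ (Real.exp_nonneg _),
      ← ENNReal.ofReal_coe_nnreal]
    refine ENNReal.ofReal_le_ofReal ?_
    linarith [Real.add_one_le_exp (-(x : ℝ))]

/-- Together with `one_sub_expNeg_le` this encloses `1 - exp(-x)` between `x exp(-x)` and `x`. The
two bounds replace a differentiation in the comparison of Laplace transforms. -/
lemma mul_expNeg_le (x : ℝ≥0∞) : x * expNeg x ≤ 1 - expNeg x := by
  by_cases h : x = ∞
  · simp [h]
  · lift x to ℝ≥0 using h
    have := expNeg_ofReal x.2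
    simp only [NNReal.val_eq_coe, ENNReal.ofReal_coe_nnreal] at this
    rw [this, ← ENNReal.ofReal_one, ← ENNReal.ofReal_sub _ (Real.exp_nonneg _),
      ← ENNReal.ofReal_coe_nnreal, ← ENNReal.ofReal_mul x.coe_nonneg]
    refine ENNReal.ofReal_le_ofReal ?_
    have h1 := Real.add_one_le_exp (x : ℝ)
    have h2 : Real.exp (x : ℝ) * Real.exp (-(x : ℝ)) = 1 := by rw [← Real.exp_add]; simp
    nlinarith [Real.exp_pos (-(x : ℝ))]

/-- The function `-log` from `[0, 1]` to `[0, ∞]`. -/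
noncomputable def negLog (x : ℝ≥0∞) : ℝ≥0∞ := (-ENNReal.log x).toENNReal

@[fun_prop] lemma Measurable.negLog {α : Type*} {_ : MeasurableSpace α} {f : α → ℝ≥0∞}
    (hf : Measurable f) : Measurable fun x => negLog (f x) := by
  unfold RuelleCascade.negLog
  exact (measurable_ereal_toENNReal.comp (continuous_neg.measurable.comp hf.ennreal_log))

/-- Turns a product of factors in `[0, 1]`, zero included, into the exponential of a sum, which is
the form that the Laplace functional accepts. -/
lemma expNeg_negLog {x : ℝ≥0∞} (hx : x ≤ 1) : expNeg (negLog x) = x := by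
  rw [expNeg, negLog, EReal.coe_toENNReal (by simpa using hx), neg_neg, ENNReal.exp_log]

lemma lintegral_expNeg_poisson (r : ℝ≥0) (c : ℝ≥0) :
    ∫⁻ n : ℕ, expNeg (c * n) ∂(poissonMeasure r) = expNeg (r * (1 - expNeg c)) := by
  have hc := expNeg_ofReal c.2
  simp only [NNReal.val_eq_coe, ENNReal.ofReal_coe_nnreal] at hc
  have hr : (r : ℝ≥0∞) * (1 - expNeg c) = ENNReal.ofReal (r * (1 - Real.exp (-c))) := by
    rw [hc, ENNReal.ofReal_mul r.coe_nonneg, ENNReal.ofReal_sub _ (Real.exp_nonneg _)]; simp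
  have h1 : Real.exp (-(c : ℝ)) ≤ 1 := by simp
  have hs : HasSum (fun n : ℕ => Real.exp (-(r : ℝ)) *
      (((r : ℝ) * Real.exp (-c)) ^ n / n.factorial))
      (Real.exp (-r) * Real.exp (r * Real.exp (-c))) := by
    refine HasSum.mul_left _ ?_
    have := NormedSpace.expSeries_div_hasSum_exp (𝔸 := ℝ) ((r : ℝ) * Real.exp (-c))
    rwa [← Real.exp_eq_exp_ℝ] at this
  rw [lintegral_countable', hr, expNeg_ofReal (by nlinarith [NNReal.coe_nonneg r]),
    show -(r * (1 - Real.exp (-(c : ℝ)))) = -(r : ℝ) + r * Real.exp (-c) by ring, Real.exp_add,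
    ← hs.tsum_eq, ENNReal.ofReal_tsum_of_nonneg (fun n => by positivity) hs.summable]
  refine tsum_congr fun n => ?_
  have h3 : (c : ℝ≥0∞) * n = ENNReal.ofReal (c * n) := by
    rw [ENNReal.ofReal_mul c.coe_nonneg]; simp
  rw [poissonMeasure_singleton, h3, expNeg_ofReal (by positivity),
    ← ENNReal.ofReal_mul (Real.exp_nonneg _)]
  congr 1
  rw [mul_pow, ← Real.exp_nat_mul]
  ring_nf

variable {Ω : Type*} [MeasurableSpace Ω] {P : Measure Ω}

lemma IsPoissonEnumeration.lintegral_expNeg_pointCount {m : ℝ} {u : ℕ → Ω → ℝ}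
    (hu : IsPoissonEnumeration P m u) {A : Set ℝ} (hA : MeasurableSet A)
    (hA' : intensity m A ≠ ∞) (c : ℝ≥0) :
    ∫⁻ ω, expNeg (c * (pointCount u A ω : ℝ≥0∞)) ∂P =
      expNeg (intensity m A * (1 - expNeg c)) := by
  have h := hu.law_of_ne_top A hA hA'
  have hf : Measurable fun n : ℕ∞ => expNeg (c * (n : ℝ≥0∞)) := measurable_from_top
  rw [← lintegral_map' (f := fun n : ℕ∞ => expNeg (c * (n : ℝ≥0∞))) hf.aemeasurable h.aemeasurable,
    h.map_eq, lintegral_map hf measurable_from_top]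
  simp only [ENat.toENNReal_coe]
  rw [lintegral_expNeg_poisson, ENNReal.coe_toNNReal hA']

/-- Points are grouped by the value of `f`. The value `0` is left out because its fiber may contain
infinitely many points. -/
lemma tsum_simpleFunc_eq (f : SimpleFunc ℝ ℝ≥0∞) {Ω : Type*} (u : ℕ → Ω → ℝ) (ω : Ω) :
    ∑' n, f (u n ω) = ∑ c ∈ f.range.filter (· ≠ 0), c * (pointCount u (f ⁻¹' {c}) ω : ℝ≥0∞) := by
  classical
  have h (x : ℝ) : f x = ∑ c ∈ f.range.filter (· ≠ 0), c * (f ⁻¹' {c}).indicator 1 x := by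
    by_cases hx : f x = 0
    · rw [hx, eq_comm]
      refine Finset.sum_eq_zero fun c hc => ?_
      have : c ≠ 0 := (Finset.mem_filter.1 hc).2
      simp [Set.indicator, hx, this.symm]
    · rw [Finset.sum_eq_single (f x)]
      · simp
      · intro c _ hc
        simp [Set.indicator, hc.symm]
      · intro hc; simp [hx] at hc
  rw [tsum_congr fun n => h (u n ω), Summable.tsum_finsetSum fun _ _ => ENNReal.summable]
  refine Finset.sum_congr rfl fun c _ => ?_
  rw [ENNReal.tsum_mul_left, pointCount, ← ENNReal.tsum_set_one, tsum_subtype _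
    (fun _ => (1 : ℝ≥0∞))]
  rfl

lemma measurable_pointCount {u : ℕ → Ω → ℝ} (hu : ∀ n, Measurable (u n)) {A : Set ℝ}
    (hA : MeasurableSet A) : Measurable fun ω => (pointCount u A ω : ℝ≥0∞) := by
  have h (ω : Ω) : (pointCount u A ω : ℝ≥0∞) = ∑' n, A.indicator 1 (u n ω) := by
    rw [pointCount, ← ENNReal.tsum_set_one, tsum_subtype _ (fun _ => (1 : ℝ≥0∞))]
    rfl
  simp_rw [h]
  exact Measurable.tsum fun n => (measurable_one.indicator hA).comp (hu n)

/-- The fibers of `f` are disjoint, so their counts are independent Poisson variables and the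
transforms multiply. -/
lemma IsPoissonEnumeration.lintegral_expNeg_simpleFunc [IsProbabilityMeasure P] {m : ℝ}
    {u : ℕ → Ω → ℝ} (hu : IsPoissonEnumeration P m u) (f : SimpleFunc ℝ ℝ≥0∞)
    (hf : ∀ x, f x ≠ ∞) (hf' : ∀ c, c ≠ 0 → intensity m (f ⁻¹' {c}) ≠ ∞) :
    ∫⁻ ω, expNeg (∑' n, f (u n ω)) ∂P = expNeg (∫⁻ x, 1 - expNeg (f x) ∂(intensity m)) := by
  classical
  set s := f.range.filter (· ≠ 0) with hs
  have hsum : ∫⁻ x, 1 - expNeg (f x) ∂(intensity m) =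
      ∑ c ∈ s, intensity m (f ⁻¹' {c}) * (1 - expNeg c) := by
    have : (fun x => 1 - expNeg (f x)) = f.map (fun c => 1 - expNeg c) := rfl
    rw [this, SimpleFunc.lintegral_eq_lintegral, SimpleFunc.map_lintegral, hs, Finset.sum_filter]
    refine Finset.sum_congr rfl fun c _ => ?_
    split_ifs with h
    · rw [mul_comm]
    · simp at h; simp [h]
  let e := s.equivFin
  have hind := hu.indep s.card (fun i => f ⁻¹' {(e.symm i : ℝ≥0∞)})
    (fun i => f.measurableSet_fiber _) (fun i j hij => by
      refine Disjoint.preimage _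
        (by simpa [Subtype.ext_iff] using fun h => hij (e.symm.injective (Subtype.ext h))))
  have h2 := hind.comp (fun i (n : ℕ∞) => expNeg ((e.symm i : ℝ≥0∞) * (n : ℝ≥0∞)))
    (fun i => measurable_from_top)
  have key : ∀ ω, expNeg (∑' n, f (u n ω)) = ∏ i : Fin s.card, expNeg ((e.symm i : ℝ≥0∞) *
      (pointCount u (f ⁻¹' {(e.symm i : ℝ≥0∞)}) ω : ℝ≥0∞)) := fun ω => by
    rw [tsum_simpleFunc_eq, expNeg_sum, ← hs, ← Finset.prod_coe_sort]
    exact (Equiv.prod_comp e.symm (fun c : s => expNeg ((c : ℝ≥0∞) *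
      (pointCount u (f ⁻¹' {(c : ℝ≥0∞)}) ω : ℝ≥0∞)))).symm
  simp_rw [key]
  refine (lintegral_prod_eq_prod_lintegral_of_indepFun Finset.univ _ h2 fun i => ?_).trans ?_
  · have := measurable_pointCount hu.measurable (f.measurableSet_fiber (e.symm i : ℝ≥0∞))
    simp only [Function.comp_def]
    fun_prop
  rw [hsum, expNeg_sum, ← Finset.prod_coe_sort s, ← Equiv.prod_comp e.symm]
  refine Finset.prod_congr rfl fun i _ => ?_
  have hi := Finset.mem_filter.1 (e.symm i).2
  obtain ⟨x, hx⟩ := SimpleFunc.mem_range.1 hi.1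
  have htop : (e.symm i : ℝ≥0∞) ≠ ∞ := hx ▸ hf x
  have h4 := hu.lintegral_expNeg_pointCount (f.measurableSet_fiber (e.symm i : ℝ≥0∞)) (hf' _ hi.2)
    (e.symm i : ℝ≥0∞).toNNReal
  rwa [ENNReal.coe_toNNReal htop] at h4

lemma intensity_Ioi_ne_top {m : ℝ} (hm : 0 < m) {ε : ℝ} (hε : 0 < ε) :
    intensity m (Set.Ioi ε) ≠ ∞ := by
  rw [intensity, withDensity_apply _ measurableSet_Ioi, Measure.restrict_restrict measurableSet_Ioi,
    Set.inter_eq_left.2 (Set.Ioi_subset_Ioi hε.le)]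
  exact ((integrableOn_Ioi_rpow_iff hε).2 (by linarith)).lintegral_lt_top.ne

lemma intensity_Iic (m : ℝ) : intensity m (Set.Iic 0) = 0 := by
  rw [intensity, withDensity_apply _ measurableSet_Iic, Measure.restrict_restrict measurableSet_Iic,
    Set.Iic_inter_Ioi]
  simp

lemma ae_intensity (m : ℝ) : ∀ᵐ x ∂(intensity m), 0 < x := by
  simp only [ae_iff, not_lt]
  exact intensity_Iic m

/-- The Laplace functional of a Poisson process. -/
theorem IsPoissonEnumeration.lintegral_expNeg_tsum [IsProbabilityMeasure P] {m : ℝ} (hm : 0 < m)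
    {u : ℕ → Ω → ℝ} (hu : IsPoissonEnumeration P m u) {f : ℝ → ℝ≥0∞} (hf : Measurable f) :
    ∫⁻ ω, expNeg (∑' n, f (u n ω)) ∂P = expNeg (∫⁻ x, 1 - expNeg (f x) ∂(intensity m)) := by
  -- The cutoff `1 / (j + 1)` keeps away from `0`, where the intensity is infinite. On `(0, ∞)` the
  -- truncated simple functions still increase to `f`.
  let F (j : ℕ) : SimpleFunc ℝ ℝ≥0∞ := (SimpleFunc.eapprox f j).restrict
    (Set.Ioi (1 / ((j : ℝ) + 1)))
  have hFx (j x) : F j x = (Set.Ioi (1 / ((j : ℝ) + 1))).indicator (SimpleFunc.eapprox f j) x := by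
    simp [F, SimpleFunc.restrict_apply _ measurableSet_Ioi]
  have hpos (j : ℕ) : 0 < 1 / ((j : ℝ) + 1) := by positivity
  have hF (j : ℕ) : ∫⁻ ω, expNeg (∑' n, F j (u n ω)) ∂P =
      expNeg (∫⁻ x, 1 - expNeg (F j x) ∂(intensity m)) := by
    refine hu.lintegral_expNeg_simpleFunc _ (fun x => ?_) (fun c hc => ?_)
    · rw [hFx, Set.indicator]
      split_ifs
      · exact (SimpleFunc.eapprox_lt_top f j x).ne
      · simp
    · refine ne_top_of_le_ne_top (intensity_Ioi_ne_top hm (hpos j)) (measure_mono fun x hx => ?_)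
      by_contra hx'
      rw [Set.mem_preimage, hFx, Set.indicator_of_notMem hx'] at hx
      exact hc hx.symm
  have hmono (x : ℝ) : Monotone fun j => F j x := by
    intro i j hij
    simp only [hFx]
    have h1 := one_div_le_one_div_of_le (by positivity : 0 < (i : ℝ) + 1)
      (by gcongr : (i : ℝ) + 1 ≤ (j : ℝ) + 1)
    refine (Set.indicator_le_indicator_of_subset (Set.Ioi_subset_Ioi h1)
      (fun _ => zero_le) x).trans ?_
    exact Set.indicator_le_indicator (SimpleFunc.monotone_eapprox f hij x)
  have hlim (x : ℝ) (hx : 0 < x) : Tendsto (fun j => F j x) atTop (𝓝 (f x)) := by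
    have h1 := tendsto_atTop_iSup (fun i j hij => SimpleFunc.monotone_eapprox f hij x)
    rw [SimpleFunc.iSup_eapprox_apply hf] at h1
    refine h1.congr' ?_
    filter_upwards [tendsto_one_div_add_atTop_nhds_zero_nat.eventually (gt_mem_nhds hx)] with j hj
    rw [hFx, Set.indicator_of_mem (show x ∈ Set.Ioi _ from hj)]
  have hl : Tendsto (fun j => ∫⁻ ω, expNeg (∑' n, F j (u n ω)) ∂P) atTop
      (𝓝 (∫⁻ ω, expNeg (∑' n, f (u n ω)) ∂P)) := by
    refine tendsto_lintegral_of_dominated_convergence (fun _ => 1) (fun j => ?_) (fun j => ?_)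
      (by simp) ?_
    · have := hu.measurable
      have := (F j).measurable
      fun_prop
    · exact ae_of_all _ fun ω => expNeg_le_one _
    · filter_upwards [hu.pos] with ω hω
      refine (expNeg_continuous.tendsto _).comp ?_
      simp only [← lintegral_count]
      exact lintegral_tendsto_of_tendsto_of_monotone
        (fun _ => (measurable_of_countable _).aemeasurable)
        (ae_of_all _ fun n => hmono _) (ae_of_all _ fun n => hlim _ (hω n))
  have hr : Tendsto (fun j => expNeg (∫⁻ x, 1 - expNeg (F j x) ∂(intensity m))) atTop
      (𝓝 (expNeg (∫⁻ x, 1 - expNeg (f x) ∂(intensity m)))) := by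
    refine (expNeg_continuous.tendsto _).comp ?_
    refine lintegral_tendsto_of_tendsto_of_monotone (fun j => ?_) ?_ ?_
    · have := (F j).measurable
      fun_prop
    · exact ae_of_all _ fun x i j hij => tsub_le_tsub_left (expNeg_antitone (hmono x hij)) _
    · filter_upwards [ae_intensity m] with x hx
      exact ENNReal.Tendsto.sub tendsto_const_nhds ((expNeg_continuous.tendsto _).comp (hlim x hx))
        (Or.inl ENNReal.one_ne_top)
  simp_rw [hF] at hl
  exact tendsto_nhds_unique hl hr

end

/-! ### Scaling of the intensity, and the constants of the Laplace exponents. -/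

section

lemma lintegral_intensity {m : ℝ} {f : ℝ → ℝ≥0∞} (hf : Measurable f) :
    ∫⁻ x, f x ∂(intensity m) = ∫⁻ x in Set.Ioi 0, ENNReal.ofReal (x ^ (-1 - m)) * f x := by
  rw [intensity, lintegral_withDensity_eq_lintegral_mul _ (by fun_prop) hf]
  rfl

/-- Substituting `c x` in a density homogeneous of degree `-1 - m` produces `c^(1+m)`, and `dx`
takes one factor `c` back. -/
lemma lintegral_intensity_comp_mul {m : ℝ} {f : ℝ → ℝ≥0∞} (hf : Measurable f) {c : ℝ}
    (hc : 0 < c) :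
    ∫⁻ x, f (c * x) ∂(intensity m) = ENNReal.ofReal (c ^ m) * ∫⁻ x, f x ∂(intensity m) := by
  rw [lintegral_intensity (by fun_prop), lintegral_intensity hf,
    ← lintegral_indicator measurableSet_Ioi, ← lintegral_indicator measurableSet_Ioi]
  set g := (Set.Ioi (0 : ℝ)).indicator fun x => ENNReal.ofReal (x ^ (-1 - m)) * f x with hg
  have hgm : Measurable g := Measurable.indicator (by fun_prop) measurableSet_Ioi
  have h (x : ℝ) : (Set.Ioi (0 : ℝ)).indicator
      (fun x => ENNReal.ofReal (x ^ (-1 - m)) * f (c * x)) x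
      = ENNReal.ofReal (c ^ (1 + m)) * g (c * x) := by
    by_cases hx : 0 < x
    · have hcx : 0 < c * x := mul_pos hc hx
      rw [hg, Set.indicator_of_mem (show x ∈ Set.Ioi 0 from hx),
        Set.indicator_of_mem (show c * x ∈ Set.Ioi 0 from hcx), ← mul_assoc,
        ← ENNReal.ofReal_mul (by positivity), Real.mul_rpow hc.le hx.le, ← mul_assoc,
        ← Real.rpow_add hc]
      simp
    · have hcx : ¬ 0 < c * x := by rwa [mul_pos_iff_of_pos_left hc]
      rw [hg, Set.indicator_of_notMem (show x ∉ Set.Ioi 0 from hx),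
        Set.indicator_of_notMem (show c * x ∉ Set.Ioi 0 from hcx), mul_zero]
  simp_rw [h]
  rw [lintegral_const_mul _ (by fun_prop),
    ← lintegral_map (f := g) (g := fun x => c * x) hgm (by fun_prop),
    Real.map_volume_mul_left hc.ne', lintegral_smul_measure, smul_eq_mul, ← mul_assoc,
    ← ENNReal.ofReal_mul (by positivity), abs_of_pos (inv_pos.2 hc), Real.rpow_add hc,
      Real.rpow_one]
  congr 2
  field_simp

lemma intensity_ne_zero (m : ℝ) : intensity m ≠ 0 := by
  intro h
  have h1 := congrArg (fun μ => μ Set.univ) h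
  simp only [intensity, Measure.coe_zero, Pi.zero_apply] at h1
  rw [withDensity_apply _ MeasurableSet.univ, Measure.restrict_univ,
    lintegral_eq_zero_iff (by fun_prop), Filter.EventuallyEq, ae_restrict_iff' measurableSet_Ioi]
      at h1
  have h2 : ∀ᵐ x : ℝ, x ∉ Set.Ioi (0 : ℝ) := by
    filter_upwards [h1] with x hx hx'
    have := hx hx'
    simp only [Pi.zero_apply, ENNReal.ofReal_eq_zero] at this
    exact absurd (Real.rpow_pos_of_pos hx' _) this.not_gt
  have h3 : volume (Set.Ioi (0 : ℝ)) = 0 := measure_eq_zero_iff_ae_notMem.2 h2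
  simp at h3

/-- The exponent of the Laplace transform of a Poisson process with weights whose Laplace transform
is `x ↦ exp (-K x ^ p)`. -/
noncomputable def tailConst (m p : ℝ) (K : ℝ≥0∞) : ℝ≥0∞ :=
  ∫⁻ x, 1 - expNeg (K * ENNReal.ofReal x ^ p) ∂(intensity m)

lemma tailConst_ne_zero {m p : ℝ} (hp : 0 < p) {K : ℝ≥0∞} (hK : K ≠ 0) : tailConst m p K ≠ 0 := by
  intro h
  rw [tailConst, lintegral_eq_zero_iff (by fun_prop)] at h
  have : ∀ᵐ x ∂(intensity m), False := by
    filter_upwards [h, ae_intensity m] with x hx hx0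
    rw [Pi.zero_apply, tsub_eq_zero_iff_le] at hx
    refine hx.not_gt (expNeg_lt_one (mul_ne_zero hK ?_))
    simp [ENNReal.rpow_eq_zero_iff, hp, hx0, hp.not_gt]
  simp [intensity_ne_zero] at this

/-- On `(0, 1]` the integrand is at most `K x^p`, and `x^(p-1-m)` is integrable since `m < p`.
Beyond `1` the integrand is at most `1` and the intensity is finite since `0 < m`. This is why the
exponents of the cascade have to increase and stay below `1`. -/
lemma tailConst_ne_top {m p : ℝ} (hm : 0 < m) (hp : m < p) {K : ℝ≥0∞} (hK : K ≠ ∞) :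
    tailConst m p K ≠ ∞ := by
  have hle : tailConst m p K ≤ ∫⁻ x, (Set.Ioc 0 1).indicator
      (fun x => K * ENNReal.ofReal x ^ p) x + (Set.Ioi 1).indicator 1 x ∂(intensity m) := by
    refine lintegral_mono_ae ?_
    filter_upwards [ae_intensity m] with x hx
    by_cases h1 : x ≤ 1
    · rw [Set.indicator_of_mem (show x ∈ Set.Ioc 0 1 from ⟨hx, h1⟩)]
      exact (one_sub_expNeg_le _).trans le_self_add
    · rw [Set.indicator_of_mem (show x ∈ Set.Ioi 1 from not_le.1 h1)]
      exact tsub_le_self.trans le_add_self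
  refine ne_top_of_le_ne_top ?_ hle
  rw [lintegral_add_left (Measurable.indicator (by fun_prop) measurableSet_Ioc)]
  refine ENNReal.add_ne_top.2 ⟨?_, ?_⟩
  · have hm' : Measurable ((Set.Ioc (0 : ℝ) 1).indicator fun x => K * ENNReal.ofReal x ^ p) :=
      Measurable.indicator (by fun_prop) measurableSet_Ioc
    rw [lintegral_intensity hm']
    have h2 : ∫⁻ x in Set.Ioi (0 : ℝ), ENNReal.ofReal (x ^ (-1 - m)) *
        (Set.Ioc 0 1).indicator (fun x => K * ENNReal.ofReal x ^ p) x =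
        K * ∫⁻ x in Set.Ioc (0 : ℝ) 1, ENNReal.ofReal (x ^ (p - 1 - m)) := by
      rw [← lintegral_const_mul _ (by fun_prop), ← lintegral_indicator measurableSet_Ioi,
        ← lintegral_indicator measurableSet_Ioc]
      congr 1
      ext x
      by_cases hx : 0 < x
      · by_cases h1 : x ≤ 1
        · rw [Set.indicator_of_mem (show x ∈ Set.Ioi 0 from hx), Set.indicator_of_mem
            (show x ∈ Set.Ioc 0 1 from ⟨hx, h1⟩), Set.indicator_of_mem
            (show x ∈ Set.Ioc 0 1 from ⟨hx, h1⟩), ENNReal.ofReal_rpow_of_pos hx, mul_left_comm,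
            ← ENNReal.ofReal_mul (by positivity), ← Real.rpow_add hx]
          congr 3
          ring
        · simp [hx, h1]
      · simp [hx]
    rw [h2]
    refine ENNReal.mul_ne_top hK ?_
    have := (intervalIntegral.intervalIntegrable_rpow' (a := 0) (b := 1)
      (show -1 < p - 1 - m by linarith))
    rw [intervalIntegrable_iff_integrableOn_Ioc_of_le zero_le_one] at this
    exact this.lintegral_lt_top.ne
  · rw [lintegral_indicator_one measurableSet_Ioi]
    exact intensity_Ioi_ne_top hm one_pos

/-- Scaling gives this for finite `c > 0`. The value `c = ∞` is needed as well, because nested norms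
may be infinite; there the integral dominates its values at `c = n + 1`, which tend to `∞`. -/
lemma lintegral_one_sub_expNeg_mul {m p : ℝ} (hm : 0 < m) (hp : m < p) {K : ℝ≥0∞} (hK0 : K ≠ 0)
    (c : ℝ≥0∞) :
    ∫⁻ x, 1 - expNeg (K * (c * ENNReal.ofReal x) ^ p) ∂(intensity m) = c ^ m * tailConst m p K := by
  have hp0 : 0 < p := hm.trans hp
  have hfin (c : ℝ) (hc : 0 < c) :
      ∫⁻ x, 1 - expNeg (K * (ENNReal.ofReal c * ENNReal.ofReal x) ^ p) ∂(intensity m) =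
        ENNReal.ofReal c ^ m * tailConst m p K := by
    simp_rw [← ENNReal.ofReal_mul hc.le]
    rw [lintegral_intensity_comp_mul (f := fun x => 1 - expNeg (K * ENNReal.ofReal x ^ p))
      (by fun_prop) hc, ENNReal.ofReal_rpow_of_pos hc, tailConst]
  rcases eq_or_ne c 0 with rfl | hc0
  · simp [hp0, hm]
  rcases eq_or_ne c ∞ with rfl | hc
  · rw [ENNReal.top_rpow_of_pos hm, ENNReal.top_mul (tailConst_ne_zero hp0 hK0)]
    have h1 (n : ℕ) : ((n : ℝ≥0∞) + 1) ^ m * tailConst m p K ≤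
        ∫⁻ x, 1 - expNeg (K * (∞ * ENNReal.ofReal x) ^ p) ∂(intensity m) := by
      have h2 : (n : ℝ≥0∞) + 1 = ENNReal.ofReal (n + 1) := by
        rw [ENNReal.ofReal_add (by positivity) zero_le_one]; simp
      rw [h2, ← hfin _ (by positivity)]
      refine lintegral_mono fun x => tsub_le_tsub_left (expNeg_antitone ?_) _
      gcongr
      exact le_top
    have h3 : Tendsto (fun n : ℕ => ((n : ℝ≥0∞) + 1) ^ m * tailConst m p K) atTop (𝓝 ∞) := by
      have h4 : Tendsto (fun n : ℕ => (n : ℝ≥0∞) + 1) atTop (𝓝 ∞) := by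
        have := (tendsto_add_atTop_iff_nat 1).2 ENNReal.tendsto_nat_nhds_top
        simpa using this
      have h5 := ((ENNReal.continuous_rpow_const (y := m)).tendsto ∞).comp h4
      have h6 := ENNReal.Tendsto.mul_const h5 (b := tailConst m p K)
        (Or.inl (by simp [ENNReal.top_rpow_of_pos hm]))
      rwa [ENNReal.top_rpow_of_pos hm, ENNReal.top_mul (tailConst_ne_zero hp0 hK0)] at h6
    exact top_unique (le_of_tendsto' h3 h1)
  · have := hfin c.toReal (ENNReal.toReal_pos hc0 hc)
    rwa [ENNReal.ofReal_toReal hc] at this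

end

/-! ### Nodes, children, and the conditional laws of labels. -/

section

variable {k : ℕ} {𝒳 : Fin k → Type*} {Ω : Type*}

/-- The child number `n` of the node `a`. -/
def child {l : Fin k} (a : Fin l.castSucc → ℕ) (n : ℕ) : Fin l.succ → ℕ :=
  Fin.snoc (α := fun _ : Fin (l + 1) => ℕ) a n

lemma child_castSucc {l : Fin k} (a : Fin l.castSucc → ℕ) (n : ℕ) (j : Fin l) :
    child a n (Fin.castSucc j : Fin (l + 1)) = a j :=
  Fin.snoc_castSucc (α := fun _ : Fin (l + 1) => ℕ) n a j

lemma child_last {l : Fin k} (a : Fin l.castSucc → ℕ) (n : ℕ) :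
    child a n (Fin.last l : Fin (l + 1)) = n :=
  Fin.snoc_last (α := fun _ : Fin (l + 1) => ℕ) n a

/-- A node on level `l + 1` is a child of a node on level `l`. -/
def childEquiv (l : Fin k) : (Fin l.castSucc → ℕ) × ℕ ≃ (Fin l.succ → ℕ) where
  toFun p := child p.1 p.2
  invFun b := (Fin.init (α := fun _ : Fin (l + 1) => ℕ) b, b (Fin.last l))
  left_inv p := Prod.ext (funext fun j => child_castSucc p.1 p.2 j) (child_last p.1 p.2)
  right_inv b := Fin.snoc_init_self (α := fun _ : Fin (l + 1) => ℕ) b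

lemma append_castSucc (l : Fin k) (x : Prefix 𝒳 l.castSucc) (y : 𝒳 l) (j : Fin l) :
    append l x y (Fin.castSucc j : Fin (l + 1)) = x j :=
  Fin.snoc_castSucc (α := fun i : Fin (l + 1) => 𝒳 (i.castLE l.isLt)) y x j

lemma append_last (l : Fin k) (x : Prefix 𝒳 l.castSucc) (y : 𝒳 l) :
    append l x y (Fin.last l : Fin (l + 1)) = y :=
  Fin.snoc_last (α := fun i : Fin (l + 1) => 𝒳 (i.castLE l.isLt)) y x

lemma append_labels (z : (l : Fin k) → (Fin l → ℕ) → ℕ → Ω → 𝒳 l) (l : Fin k)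
    (a : Fin l.castSucc → ℕ) (n : ℕ) (ω : Ω) :
    append l (labels z l.castSucc a ω) (z l a n ω) = labels z l.succ (child a n) ω := by
  funext i
  refine Fin.lastCases (n := l) ?_ (fun j => ?_) i
  · rw [append_last]
    have h1 : (fun j : Fin l => child a n (Fin.castSucc j : Fin (l + 1))) = a :=
      funext fun j => child_castSucc a n j
    change z l a n ω = z l (fun j : Fin l => child a n (Fin.castSucc j : Fin (l + 1)))
      (child a n (Fin.last l : Fin (l + 1))) ω
    rw [h1, child_last]
  · rw [append_castSucc]
    have h1 : (fun i : Fin j => child a n (Fin.castSucc (i.castLE j.isLt.le) : Fin (l + 1))) =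
      fun i : Fin j => a (i.castLE j.isLt.le) := funext fun i => child_castSucc a n _
    change z (j.castLE l.isLt.le) (fun i : Fin j => a (i.castLE j.isLt.le)) (a j) ω =
      z (j.castLE l.isLt.le)
        (fun i : Fin j => child a n (Fin.castSucc (i.castLE j.isLt.le) : Fin (l + 1)))
      (child a n (Fin.castSucc j : Fin (l + 1))) ω
    rw [h1, child_castSucc]

variable [∀ l, MeasurableSpace (𝒳 l)]

lemma measurable_append (l : Fin k) :
    Measurable fun p : Prefix 𝒳 l.castSucc × 𝒳 l => append l p.1 p.2 := by
  refine measurable_pi_iff.2 fun i => ?_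
  refine Fin.lastCases (n := l) ?_ (fun j => ?_) i
  · simp only [append_last]
    exact measurable_snd
  · simp only [append_castSucc]
    exact (measurable_pi_apply j).comp measurable_fst

variable [MeasurableSpace Ω] {P : Measure Ω} {ν : (l : Fin k) → Prefix 𝒳 l.castSucc → Measure (𝒳 l)}
  {z : (l : Fin k) → (Fin l → ℕ) → ℕ → Ω → 𝒳 l}

lemma measurable_labels (hz : ∀ l a n, Measurable (z l a n)) (l : Fin (k + 1)) (a : Fin l → ℕ) :
    Measurable (labels z l a) :=
  measurable_pi_iff.2 fun _ => hz _ _ _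

omit [MeasurableSpace Ω] in
lemma measurable_history_label {l j : Fin k} (hj : j < l) (a : Fin j → ℕ) (n : ℕ) :
    Measurable[history z l] (z j a n) := by
  rw [measurable_iff_comap_le]
  exact le_iSup_of_le j (le_iSup_of_le hj (le_iSup_of_le a
    (le_iSup (fun n => MeasurableSpace.comap (z j a n) inferInstance) n)))

omit [MeasurableSpace Ω] in
lemma measurable_history_labels (l : Fin k) (a : Fin l.castSucc → ℕ) :
    Measurable[history z l] (labels z l.castSucc a) :=
  @measurable_pi_iff _ _ _ (history z l) _ _ |>.2 fun i => measurable_history_label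
    (show i.castLE _ < l from i.isLt) _ _

/-- The joint law of the labels of a node and the label of one of its children. -/
lemma IsTreeProcess.map_labels [IsFiniteMeasure P]
    {κ : (l : Fin k) → Kernel (Prefix 𝒳 l.castSucc) (𝒳 l)}
    [∀ l, IsSFiniteKernel (κ l)] (hz : IsTreeProcess P (fun l x => κ l x) z) (l : Fin k)
    (a : Fin l.castSucc → ℕ) (n : ℕ) :
    P.map (fun ω => (labels z l.castSucc a ω, z l a n ω)) = P.map
      (labels z l.castSucc a) ⊗ₘ κ l := by
  have hl := measurable_labels hz.measurable l.castSucc a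
  refine Measure.ext_prod fun {s t} hs ht => ?_
  rw [Measure.compProd_apply_prod hs ht, Measure.map_apply (hl.prodMk (hz.measurable l a n))
    (hs.prod ht),
    setLIntegral_map hs ((κ l).measurable_coe ht) hl]
  have h := hz.cond_law l {(a, n)} (fun _ => t) (fun _ => ht) _
    (measurable_history_labels (z := z) l a hs)
  have hpre : (fun ω => (labels z l.castSucc a ω, z l a n ω)) ⁻¹' s ×ˢ t =
    labels z l.castSucc a ⁻¹' s ∩ z l a n ⁻¹' t := rfl
  rw [hpre]
  simpa using h

lemma IsTreeProcess.lintegral_labels [IsFiniteMeasure P]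
    {κ : (l : Fin k) → Kernel (Prefix 𝒳 l.castSucc) (𝒳 l)}
    [∀ l, IsSFiniteKernel (κ l)] (hz : IsTreeProcess P (fun l x => κ l x) z) (l : Fin k)
    (a : Fin l.castSucc → ℕ) (n : ℕ) {f : Prefix 𝒳 l.succ → ℝ≥0∞} (hf : Measurable f) :
    ∫⁻ ω, f (labels z l.succ (child a n) ω) ∂P =
      ∫⁻ ω, ∫⁻ y, f (append l (labels z l.castSucc a ω) y) ∂(κ l (labels z l.castSucc a ω)) ∂P := by
  have hl := measurable_labels hz.measurable l.castSucc a
  have hf' := hf.comp (measurable_append (𝒳 := 𝒳) l)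
  have h := lintegral_map (μ := P) hf' (hl.prodMk (hz.measurable l a n))
  rw [hz.map_labels, Measure.lintegral_compProd hf', lintegral_map _ hl] at h
  · simp only [Function.comp_def, append_labels] at h
    exact h.symm
  · exact hf'.lintegral_kernel_prod_right'

/-- The probability of the complement is the mean of its conditional probabilities, so these vanish
almost surely. This is the induction tool for properties that hold only almost surely along the
tree: it passes from a child to its parent. -/
lemma IsTreeProcess.ae_labels [IsFiniteMeasure P]
    {κ : (l : Fin k) → Kernel (Prefix 𝒳 l.castSucc) (𝒳 l)}
    [∀ l, IsSFiniteKernel (κ l)] (hz : IsTreeProcess P (fun l x => κ l x) z) (l : Fin k)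
    (a : Fin l.castSucc → ℕ) (n : ℕ) {s : Set (Prefix 𝒳 l.succ)} (hs : MeasurableSet s)
    (h : ∀ᵐ ω ∂P, labels z l.succ (child a n) ω ∈ s) :
    ∀ᵐ ω ∂P, ∀ᵐ y ∂(κ l (labels z l.castSucc a ω)), append l (labels z l.castSucc a ω) y ∈ s := by
  have hl := measurable_labels hz.measurable l.castSucc a
  have h1 := hz.lintegral_labels l a n (measurable_one.indicator hs.compl)
  have hm : Measurable fun ω => ∫⁻ y, (sᶜ).indicator (1 : Prefix 𝒳 l.succ → ℝ≥0∞)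
      (append l (labels z l.castSucc a ω) y) ∂(κ l (labels z l.castSucc a ω)) :=
    (((measurable_one.indicator hs.compl).comp
      (measurable_append (𝒳 := 𝒳) l)).lintegral_kernel_prod_right').comp hl
  rw [lintegral_congr_ae (g := 0), lintegral_zero_fun, eq_comm, lintegral_eq_zero_iff hm] at h1
  · filter_upwards [h1] with ω hω
    have h2 : Measurable fun y => (sᶜ).indicator (1 : Prefix 𝒳 l.succ → ℝ≥0∞)
        (append l (labels z l.castSucc a ω) y) :=
      (measurable_one.indicator hs.compl).comp
        ((measurable_append (𝒳 := 𝒳) l).comp measurable_prodMk_left)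
    rw [Pi.zero_apply, lintegral_eq_zero_iff h2] at hω
    filter_upwards [hω] with y hy
    by_contra hc
    simp [hc] at hy
  · filter_upwards [h] with ω hω
    simp [hω]

/-- Given the labels before level `l`, the labels on level `l` are independent with laws `κ l`. -/
lemma IsTreeProcess.lintegral_prod [IsFiniteMeasure P]
    {κ : (l : Fin k) → Kernel (Prefix 𝒳 l.castSucc) (𝒳 l)}
    [∀ l, IsMarkovKernel (κ l)] (hz : IsTreeProcess P (fun l x => κ l x) z) (l : Fin k)
    (f : (Fin l → ℕ) × ℕ → Prefix 𝒳 l.castSucc × 𝒳 l → ℝ≥0∞) (hf : ∀ p, Measurable (f p))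
    (hf1 : ∀ p x, f p x ≤ 1) (S : Finset ((Fin l → ℕ) × ℕ)) :
    ∫⁻ ω, ∏ p ∈ S, f p (labels z l.castSucc p.1 ω, z l p.1 p.2 ω) ∂P =
      ∫⁻ ω, ∏ p ∈ S, ∫⁻ y, f p (labels z l.castSucc p.1 ω, y)
        ∂(κ l (labels z l.castSucc p.1 ω)) ∂P := by
  classical
  have hl := fun a => measurable_labels hz.measurable l.castSucc a
  have hz' := fun a n => hz.measurable l a n
  -- Indicators are replaced by functions one node at a time: `S` holds the nodes already replaced,
  -- `T` those that still carry indicators. Quantifying over `T`, `B` and `A` leaves room for the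
  -- test sets of the next node.
  suffices H : ∀ (S T : Finset ((Fin l → ℕ) × ℕ)) (B : (Fin l → ℕ) × ℕ → Set (𝒳 l)),
      (∀ p, MeasurableSet (B p)) → Disjoint S T → ∀ A : Set Ω, MeasurableSet[history z l] A →
      ∫⁻ ω in A, (∏ p ∈ S, f p (labels z l.castSucc p.1 ω, z l p.1 p.2 ω)) *
          ∏ p ∈ T, (B p).indicator 1 (z l p.1 p.2 ω) ∂P =
        ∫⁻ ω in A, (∏ p ∈ S, ∫⁻ y, f p (labels z l.castSucc p.1 ω, y)
          ∂(κ l (labels z l.castSucc p.1 ω))) * ∏ p ∈ T, κ l (labels z l.castSucc p.1 ω) (B p) ∂P by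
    simpa using H S ∅ (fun _ => ∅) (fun _ => MeasurableSet.empty) (by simp) Set.univ
      MeasurableSet.univ
  intro S
  induction S using Finset.induction_on with
  | empty =>
    intro T B hB _ A hA
    simp only [Finset.prod_empty, one_mul]
    rw [← hz.cond_law l T B hB A hA]
    have h1 (ω : Ω) : ∏ p ∈ T, (B p).indicator (1 : 𝒳 l → ℝ≥0∞) (z l p.1 p.2 ω) =
        (⋂ p ∈ T, z l p.1 p.2 ⁻¹' B p).indicator (1 : Ω → ℝ≥0∞) ω := by
      by_cases h : ω ∈ ⋂ p ∈ T, z l p.1 p.2 ⁻¹' B p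
      · rw [Set.indicator_of_mem h]
        refine Finset.prod_eq_one fun p hp => ?_
        simp only [Set.mem_iInter] at h
        exact Set.indicator_of_mem (show z l p.1 p.2 ω ∈ B p from h p hp) _
      · rw [Set.indicator_of_notMem h]
        simp only [Set.mem_iInter, not_forall] at h
        obtain ⟨p, hp, h⟩ := h
        exact Finset.prod_eq_zero hp (Set.indicator_of_notMem (show z l p.1 p.2 ω ∉ B p from h) _)
    simp_rw [h1]
    have h2 : MeasurableSet (⋂ p ∈ T, z l p.1 p.2 ⁻¹' B p) :=
      T.measurableSet_biInter fun p _ => hz' p.1 p.2 (hB p)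
    rw [lintegral_indicator_one h2, Measure.restrict_apply h2, Set.inter_comm]
  | insert q S hq ih =>
    intro T B hB hd A hA
    rw [Finset.disjoint_insert_left] at hd
    set r : Ω → ℝ≥0∞ := fun ω => (∏ p ∈ S, f p (labels z l.castSucc p.1 ω, z l p.1 p.2 ω)) *
          ∏ p ∈ T, (B p).indicator 1 (z l p.1 p.2 ω) with hr
    set r' : Ω → ℝ≥0∞ := fun ω => (∏ p ∈ S, ∫⁻ y, f p (labels z l.castSucc p.1 ω, y)
          ∂(κ l (labels z l.castSucc p.1 ω))) * ∏ p ∈ T, κ l (labels z l.castSucc p.1 ω)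
            (B p) with hr'
    have hrm : Measurable r := by
      refine (Finset.measurable_prod _ fun p _ => ?_).mul (Finset.measurable_prod _ fun p _ => ?_)
      · exact (hf p).comp ((hl _).prodMk (hz' _ _))
      · exact (measurable_one.indicator (hB p)).comp (hz' _ _)
    have hrm' : Measurable r' := by
      refine (Finset.measurable_prod _ fun p _ => ?_).mul (Finset.measurable_prod _ fun p _ => ?_)
      · exact (hf p).lintegral_kernel_prod_right'.comp (hl _)
      · exact ((κ l).measurable_coe (hB p)).comp (hl _)
    have hr1 (ω) : r ω ≤ 1 := by
      refine mul_le_one' (Finset.prod_le_one' fun p _ => hf1 _ _)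
        (Finset.prod_le_one' fun p _ => ?_)
      exact Set.indicator_le_self' (by simp) _
    -- The bound `f ≤ 1` enters here: a finite measure on a product is determined by rectangles.
    have hfin : IsFiniteMeasure ((P.restrict A).withDensity r) :=
      isFiniteMeasure_withDensity (ne_top_of_le_ne_top (measure_ne_top (P.restrict A) Set.univ)
        ((lintegral_mono hr1).trans (by simp)))
    -- On a rectangle `s ×ˢ t` this is the induction hypothesis, with `q` added to `T` as the
    -- indicator of `t` and with `s` absorbed into the history event `A`.
    have key : ((P.restrict A).withDensity r).map
        (fun ω => (labels z l.castSucc q.1 ω, z l q.1 q.2 ω)) =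
        ((P.restrict A).withDensity r').map (labels z l.castSucc q.1) ⊗ₘ κ l := by
      refine Measure.ext_prod fun {s t} hs ht => ?_
      have hκt : Measurable fun ω => κ l (labels z l.castSucc q.1 ω) t :=
        ((κ l).measurable_coe ht).comp (hl _)
      have hAs : MeasurableSet[history z l] (labels z l.castSucc q.1 ⁻¹' s) :=
        measurable_history_labels (z := z) l q.1 hs
      have hi := ih (insert q T) (Function.update B q t)
        (fun p => by
          by_cases hp : p = q
          · subst hp; simpa
          · simpa [hp] using hB p)
        (Finset.disjoint_insert_right.2 ⟨hq, hd.2⟩) _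
        (@MeasurableSet.inter _ (history z l) _ _ hAs hA)
      have e1 (ω) : ∏ p ∈ T, (Function.update B q t p).indicator (1 : 𝒳 l → ℝ≥0∞) (z l p.1 p.2 ω) =
          ∏ p ∈ T, (B p).indicator (1 : 𝒳 l → ℝ≥0∞) (z l p.1 p.2 ω) :=
        Finset.prod_congr rfl fun p hp => by
          rw [Function.update_of_ne (by rintro rfl; exact hd.1 hp)]
      have e2 (ω) : ∏ p ∈ T, κ l (labels z l.castSucc p.1 ω) (Function.update B q t p) =
          ∏ p ∈ T, κ l (labels z l.castSucc p.1 ω) (B p) :=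
        Finset.prod_congr rfl fun p hp => by
          rw [Function.update_of_ne (by rintro rfl; exact hd.1 hp)]
      simp only [Finset.prod_insert hd.1, Function.update_self, e1, e2] at hi
      have hpre : (fun ω => (labels z l.castSucc q.1 ω, z l q.1 q.2 ω)) ⁻¹' s ×ˢ t =
        z l q.1 q.2 ⁻¹' t ∩ labels z l.castSucc q.1 ⁻¹' s := by
        ext ω; simp [and_comm]
      rw [Measure.compProd_apply_prod hs ht, setLIntegral_map hs ((κ l).measurable_coe ht) (hl _),
        Measure.map_apply ((hl _).prodMk (hz' _ _)) (hs.prod ht), hpre,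
        withDensity_apply _ ((hz' _ _ ht).inter (hl _ hs)),
        ← Measure.restrict_restrict (hz' _ _ ht), ← lintegral_indicator (hz' _ _ ht),
        restrict_withDensity (hl _ hs),
        lintegral_withDensity_eq_lintegral_mul _ hrm' hκt,
        Measure.restrict_restrict (hl _ hs)]
      refine Eq.trans (lintegral_congr fun ω => ?_) (hi.trans (lintegral_congr fun ω => ?_))
      · by_cases h : z l q.1 q.2 ω ∈ t
        · rw [Set.indicator_of_mem (show ω ∈ z l q.1 q.2 ⁻¹' t from h), Set.indicator_of_mem h]
          simp [hr]
        · rw [Set.indicator_of_notMem (show ω ∉ z l q.1 q.2 ⁻¹' t from h),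
            Set.indicator_of_notMem h]
          simp
      · simp only [hr', Pi.mul_apply]
        ring
    have h1 := lintegral_map (μ := (P.restrict A).withDensity r) (hf q)
        ((hl q.1).prodMk (hz' q.1 q.2))
    have hk := (hf q).lintegral_kernel_prod_right' (κ := κ l)
    have hk' : Measurable fun ω => ∫⁻ y, f q (labels z l.castSucc q.1 ω, y)
      ∂(κ l (labels z l.castSucc q.1 ω)) := hk.comp (hl _)
    have hf' : Measurable fun ω => f q (labels z l.castSucc q.1 ω, z l q.1 q.2 ω) :=
      (hf q).comp ((hl _).prodMk (hz' _ _))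
    rw [key, Measure.lintegral_compProd (hf q), lintegral_map hk (hl _),
      lintegral_withDensity_eq_lintegral_mul _ hrm' hk',
      lintegral_withDensity_eq_lintegral_mul _ hrm hf'] at h1
    refine Eq.trans (lintegral_congr fun ω => ?_) (h1.symm.trans (lintegral_congr fun ω => ?_))
    · simp only [hr, Pi.mul_apply, Finset.prod_insert hq]
      ring
    · simp only [hr', Pi.mul_apply, Finset.prod_insert hq]
      ring

end

/-! ### Subtree sums, nested norms, and independence between the levels. -/

section

variable {k : ℕ} {𝒳 : Fin k → Type*} {Ω : Type*}

instance (m : ℝ) : SFinite (intensity m) := by unfold intensity; infer_instance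

/-- The exponents `m`, followed by the exponent `1`. -/
noncomputable def extExp (m : Fin k → ℝ) (l : Fin (k + 1)) : ℝ :=
  Fin.snoc (α := fun _ => ℝ) m 1 l

@[simp] lemma extExp_castSucc (m : Fin k → ℝ) (l : Fin k) : extExp m l.castSucc = m l :=
  Fin.snoc_castSucc (α := fun _ => ℝ) _ _ _

@[simp] lemma extExp_last (m : Fin k → ℝ) : extExp m (Fin.last k) = 1 :=
  Fin.snoc_last (α := fun _ => ℝ) _ _

lemma extExp_pos {m : Fin k → ℝ} (hm : ∀ l, 0 < m l) (l : Fin (k + 1)) : 0 < extExp m l := by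
  refine Fin.lastCases ?_ (fun j => ?_) l
  · simp
  · simpa using hm j

lemma lt_extExp_succ {m : Fin k → ℝ} (hm : StrictMono m) (hm1 : ∀ l, m l < 1) (l : Fin k) :
    m l < extExp m l.succ := by
  by_cases h : (l : ℕ) + 1 < k
  · have : l.succ = (⟨l + 1, h⟩ : Fin k).castSucc := rfl
    rw [this, extExp_castSucc]
    exact hm (Nat.lt_succ_self _)
  · have : l.succ = Fin.last k := Fin.ext (by have := l.isLt; simp; omega)
    rw [this, extExp_last]
    exact hm1 l

/-- The sums over the subtrees of the weights of the leaves, `g` being the weights at the leaves and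
`v` the weights of the edges. -/
noncomputable def subtreeSum (v : (l : Fin k) → (Fin l → ℕ) → ℕ → ℝ)
    (g : (Fin (Fin.last k) → ℕ) → ℝ≥0∞) (l : Fin (k + 1)) : (Fin l → ℕ) → ℝ≥0∞ :=
  Fin.reverseInduction (motive := fun l => (Fin l → ℕ) → ℝ≥0∞) g
    (fun l F a => ∑' n, ENNReal.ofReal (v l a n) * F (child a n)) l

lemma subtreeSum_last (v : (l : Fin k) → (Fin l → ℕ) → ℕ → ℝ)
    (g : (Fin (Fin.last k) → ℕ) → ℝ≥0∞) : subtreeSum v g (Fin.last k) = g := by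
  simp [subtreeSum]

lemma subtreeSum_castSucc (v : (l : Fin k) → (Fin l → ℕ) → ℕ → ℝ)
    (g : (Fin (Fin.last k) → ℕ) → ℝ≥0∞) (l : Fin k) (a : Fin l.castSucc → ℕ) :
    subtreeSum v g l.castSucc a =
      ∑' n, ENNReal.ofReal (v l a n) * subtreeSum v g l.succ (child a n) := by
  simp [subtreeSum]

lemma subtreeSum_congr {v v' : (l : Fin k) → (Fin l → ℕ) → ℕ → ℝ}
    (g : (Fin (Fin.last k) → ℕ) → ℝ≥0∞) (l : Fin (k + 1))
    (h : ∀ j : Fin k, l ≤ j.castSucc → v j = v' j) : subtreeSum v g l = subtreeSum v' g l := by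
  induction l using Fin.reverseInduction with
  | last => simp only [subtreeSum_last]
  | cast l ih =>
    funext a
    rw [subtreeSum_castSucc, subtreeSum_castSucc, h l le_rfl,
      ih fun j hj => h j ((Fin.castSucc_lt_succ).le.trans hj)]

lemma measurable_subtreeSum (l : Fin (k + 1)) (a : Fin l → ℕ) :
    Measurable fun p : ((l : Fin k) → (Fin l → ℕ) → ℕ → ℝ) × ((Fin (Fin.last k) → ℕ) → ℝ≥0∞) =>
      subtreeSum p.1 p.2 l a := by
  induction l using Fin.reverseInduction with
  | last => simp only [subtreeSum_last]; fun_prop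
  | cast l ih =>
    simp only [subtreeSum_castSucc]
    refine Measurable.tsum fun n => (Measurable.ennreal_ofReal ?_).mul (ih _)
    fun_prop

variable [∀ l, MeasurableSpace (𝒳 l)]

/-- The nested norms of a nonnegative function on the product of all the spaces. If the function is
`exp X`, the norm on level `l` is `exp X_l`. -/
noncomputable def nestedNorm (m : Fin k → ℝ) (κ : (l : Fin k) → Kernel (Prefix 𝒳 l.castSucc) (𝒳 l))
    (w : Prefix 𝒳 (Fin.last k) → ℝ≥0∞) (l : Fin (k + 1)) : Prefix 𝒳 l → ℝ≥0∞ :=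
  Fin.reverseInduction (motive := fun l => Prefix 𝒳 l → ℝ≥0∞) w
    (fun l F x => (∫⁻ y, F (append l x y) ^ m l ∂(κ l x)) ^ (1 / m l)) l

section
variable (m : Fin k → ℝ) (κ : (l : Fin k) → Kernel (Prefix 𝒳 l.castSucc) (𝒳 l))
    (w : Prefix 𝒳 (Fin.last k) → ℝ≥0∞)

lemma nestedNorm_last : nestedNorm m κ w (Fin.last k) = w := by
  simp [nestedNorm]

lemma nestedNorm_castSucc (l : Fin k) (x : Prefix 𝒳 l.castSucc) :
    nestedNorm m κ w l.castSucc x =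
      (∫⁻ y, nestedNorm m κ w l.succ (append l x y) ^ m l ∂(κ l x)) ^ (1 / m l) := by
  simp [nestedNorm]

variable {m κ w}

lemma nestedNorm_castSucc_rpow (hm : ∀ l, 0 < m l) (l : Fin k) (x : Prefix 𝒳 l.castSucc) :
    nestedNorm m κ w l.castSucc x ^ m l =
      ∫⁻ y, nestedNorm m κ w l.succ (append l x y) ^ m l ∂(κ l x) := by
  rw [nestedNorm_castSucc, ← ENNReal.rpow_mul, one_div_mul_cancel (hm l).ne', ENNReal.rpow_one]

lemma measurable_nestedNorm [∀ l, IsSFiniteKernel (κ l)] (hw : Measurable w) (l : Fin (k + 1)) :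
    Measurable (nestedNorm m κ w l) := by
  induction l using Fin.reverseInduction with
  | last => rwa [nestedNorm_last]
  | cast l ih =>
    have h : nestedNorm m κ w l.castSucc = fun x =>
      (∫⁻ y, nestedNorm m κ w l.succ (append l x y) ^ m l ∂(κ l x)) ^ (1 / m l) :=
      funext (nestedNorm_castSucc m κ w l)
    rw [h]
    refine Measurable.pow_const ?_ _
    exact ((ih.comp (measurable_append l)).pow_const (m l)).lintegral_kernel_prod_right'

end

variable [MeasurableSpace Ω] {P : Measure Ω}

lemma lintegral_comp_of_indepFun [IsProbabilityMeasure P] {E F : Type*} [MeasurableSpace E]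
    [MeasurableSpace F] {V : Ω → E} {R : Ω → F} (hV : Measurable V) (hR : Measurable R)
    (h : IndepFun V R P) {G : E × F → ℝ≥0∞} (hG : Measurable G) :
    ∫⁻ ω, G (V ω, R ω) ∂P = ∫⁻ v, ∫⁻ ω, G (v, R ω) ∂P ∂(P.map V) := by
  have := Measure.isProbabilityMeasure_map hR.aemeasurable (μ := P)
  have := Measure.isProbabilityMeasure_map hV.aemeasurable (μ := P)
  rw [← lintegral_map hG (hV.prodMk hR), (indepFun_iff_map_prod_eq_prod_map_map hV.aemeasurable
    hR.aemeasurable).1 h, lintegral_prod _ hG.aemeasurable]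
  exact lintegral_congr fun v => lintegral_map (hG.comp measurable_prodMk_left) hR

/-- Serves to join the later points and all the labels into a single block independent of the points
on level `l`. -/
lemma indepFun_prodMk_right [IsProbabilityMeasure P] {E F G : Type*} [MeasurableSpace E]
    [MeasurableSpace F] [MeasurableSpace G] {U : Ω → E} {V : Ω → F} {W : Ω → G}
    (hU : Measurable U) (hV : Measurable V) (hW : Measurable W) (h1 : IndepFun U V P)
    (h2 : IndepFun (fun ω => (U ω, V ω)) W P) : IndepFun U (fun ω => (V ω, W ω)) P := by
  have := Measure.isProbabilityMeasure_map hU.aemeasurable (μ := P)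
  have := Measure.isProbabilityMeasure_map hV.aemeasurable (μ := P)
  have := Measure.isProbabilityMeasure_map hW.aemeasurable (μ := P)
  have h3 : IndepFun V W P := h2.comp measurable_snd measurable_id
  rw [indepFun_iff_map_prod_eq_prod_map_map (by fun_prop) (by fun_prop)] at h1 h2 h3 ⊢
  rw [h3, ← Measure.prodAssoc_prod, ← h1, ← h2, Measure.map_map (by fun_prop) (by fun_prop)]
  rfl

/-- The points of the cascade on the levels after `l`. -/
def cut (l : Fin k) (v : (l : Fin k) → (Fin l → ℕ) → ℕ → ℝ) (j : Fin k) (a : Fin j → ℕ)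
    (n : ℕ) : ℝ :=
  if l < j then v j a n else 0

lemma measurable_cut (l : Fin k) : Measurable (cut l) := by
  refine measurable_pi_iff.2 fun j => measurable_pi_iff.2 fun a => measurable_pi_iff.2 fun n => ?_
  unfold cut
  split_ifs <;> fun_prop

/-- The sum below a node of level `l + 1` sees only the later edges. It is therefore a function of
the block that is independent of level `l`. -/
lemma subtreeSum_cut (v : (l : Fin k) → (Fin l → ℕ) → ℕ → ℝ)
    (g : (Fin (Fin.last k) → ℕ) → ℝ≥0∞) (l : Fin k) :
    subtreeSum (cut l v) g l.succ = subtreeSum v g l.succ := by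
  refine subtreeSum_congr g _ fun j hj => ?_
  have : l < j := Fin.succ_le_castSucc_iff.1 hj
  funext a n
  simp [cut, this]

variable {m : Fin k → ℝ} {u : (l : Fin k) → (Fin l → ℕ) → ℕ → Ω → ℝ}
  {z : (l : Fin k) → (Fin l → ℕ) → ℕ → Ω → 𝒳 l}

lemma IsCascade.measurable (hu : IsCascade P m u) : Measurable fun ω l a n => u l a n ω :=
  measurable_pi_iff.2 fun l => measurable_pi_iff.2 fun a => measurable_pi_iff.2 fun n =>
    (hu.poisson l a).measurable n

lemma IsCascade.indepFun_cut (hu : IsCascade P m u) (l : Fin k) :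
    IndepFun (fun ω a n => u l a n ω) (fun ω => cut l fun l a n => u l a n ω) P := by
  have hmeas (p : Σ l : Fin k, (Fin l → ℕ)) : Measurable fun ω n => u p.1 p.2 n ω :=
    measurable_pi_iff.2 fun n => (hu.poisson p.1 p.2).measurable n
  have h := indep_iSup_of_disjoint (μ := P) (fun p => (hmeas p).comap_le) hu.indep.iIndep
    (S := {p | p.1 = l}) (T := {p | l < p.1}) (by
      rw [Set.disjoint_left]
      rintro p rfl hp
      exact lt_irrefl p.1 hp)
  rw [IndepFun_iff_Indep]
  refine indep_of_indep_of_le_right (indep_of_indep_of_le_left h ?_) ?_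
  · rw [← measurable_iff_comap_le]
    refine @measurable_pi_iff _ _ _ (_) _ _ |>.2 fun a => ?_
    rw [measurable_iff_comap_le]
    exact le_iSup₂_of_le (⟨l, a⟩ : Σ l : Fin k, (Fin l → ℕ)) rfl le_rfl
  · rw [← measurable_iff_comap_le]
    refine @measurable_pi_iff _ _ _ (_) _ _ |>.2 fun j => ?_
    refine @measurable_pi_iff _ _ _ (_) _ _ |>.2 fun a => ?_
    unfold cut
    split_ifs with hj
    · rw [measurable_iff_comap_le]
      exact le_iSup₂_of_le (⟨j, a⟩ : Σ l : Fin k, (Fin l → ℕ)) hj le_rfl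
    · exact @measurable_const _ _ _ (_) _

lemma IsCascade.indepFun_cut_labels [IsProbabilityMeasure P] (hu : IsCascade P m u)
    (hz : ∀ l a n, Measurable (z l a n))
    (huz : IndepFun (fun ω l a n => u l a n ω) (fun ω l a n => z l a n ω) P) (l : Fin k) :
    IndepFun (fun ω a n => u l a n ω)
      (fun ω => (cut l fun l a n => u l a n ω, fun l a n => z l a n ω)) P := by
  have hum := hu.measurable
  refine indepFun_prodMk_right ((measurable_pi_apply l).comp hum) ((measurable_cut l).comp hum)
    (by fun_prop)
    (hu.indepFun_cut l) ?_
  exact huz.comp (φ := fun v : (l : Fin k) → (Fin l → ℕ) → ℕ → ℝ => (v l, cut l v)) (ψ := id)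
    ((measurable_pi_apply l).prodMk (measurable_cut l)) measurable_id

end

/-! ### The joint Laplace transform on one level, by backward induction. -/

section

variable {k : ℕ} {𝒳 : Fin k → Type*} {Ω : Type*}
variable [∀ l, MeasurableSpace (𝒳 l)] [MeasurableSpace Ω] {P : Measure Ω}
variable {m : Fin k → ℝ} {u : (l : Fin k) → (Fin l → ℕ) → ℕ → Ω → ℝ}
  {z : (l : Fin k) → (Fin l → ℕ) → ℕ → Ω → 𝒳 l}

/-- The Laplace transform of the weighted label of a child, given the label `x` of its parent. -/
noncomputable def childLaplace (m : Fin k → ℝ)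
    (κ : (l : Fin k) → Kernel (Prefix 𝒳 l.castSucc) (𝒳 l))
    (w : Prefix 𝒳 (Fin.last k) → ℝ≥0∞) (K : ℝ≥0∞) (l : Fin k) (c : ℝ≥0∞)
    (x : Prefix 𝒳 l.castSucc) : ℝ≥0∞ :=
  ∫⁻ y, expNeg (K * (c * nestedNorm m κ w l.succ (append l x y)) ^ extExp m l.succ) ∂(κ l x)

section
variable {κ : (l : Fin k) → Kernel (Prefix 𝒳 l.castSucc) (𝒳 l)} [∀ l, IsMarkovKernel (κ l)]
  {w : Prefix 𝒳 (Fin.last k) → ℝ≥0∞}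

lemma childLaplace_le_one (K : ℝ≥0∞) (l : Fin k) (c : ℝ≥0∞) (x : Prefix 𝒳 l.castSucc) :
    childLaplace m κ w K l c x ≤ 1 :=
  (lintegral_mono fun _ => expNeg_le_one _).trans (by simp)

lemma measurable_childLaplace (hw : Measurable w) (K : ℝ≥0∞) (l : Fin k) :
    Measurable fun p : ℝ≥0∞ × Prefix 𝒳 l.castSucc => childLaplace m κ w K l p.1 p.2 := by
  have h := measurable_nestedNorm (m := m) (κ := κ) hw l.succ
  have h' := measurable_append (𝒳 := 𝒳) l
  have hm : Measurable fun q : (ℝ≥0∞ × Prefix 𝒳 l.castSucc) × 𝒳 l =>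
      expNeg (K * (q.1.1 * nestedNorm m κ w l.succ (append l q.1.2 q.2)) ^ extExp m l.succ) := by
    have h2 : Measurable fun q : (ℝ≥0∞ × Prefix 𝒳 l.castSucc) × 𝒳 l =>
      nestedNorm m κ w l.succ (append l q.1.2 q.2) := (h.comp h').comp
        ((measurable_snd.comp measurable_fst).prodMk measurable_snd)
    fun_prop
  exact hm.lintegral_kernel_prod_right' (κ := (κ l).comap Prod.snd measurable_snd)

/-- The computation behind the recursion: for a fixed label of the child, scaling turns the integral
over `t` into a multiple of the `m l`-th power of the child's norm. Averaging that power over the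
child's label gives the `m l`-th power of the norm of the parent. -/
lemma lintegral_one_sub_childLaplace (hm : ∀ l, 0 < m l) {l : Fin k}
    (hm' : m l < extExp m l.succ) (hw : Measurable w) {K : ℝ≥0∞} (hK0 : K ≠ 0) (s : ℝ≥0∞)
    (x : Prefix 𝒳 l.castSucc) :
    ∫⁻ t, 1 - childLaplace m κ w K l (s * ENNReal.ofReal t) x ∂(intensity (m l)) =
      tailConst (m l) (extExp m l.succ) K * (s * nestedNorm m κ w l.castSucc x) ^ m l := by
  have h : Measurable fun y => nestedNorm m κ w l.succ (append l x y) :=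
    (measurable_nestedNorm (m := m) (κ := κ) hw l.succ).comp
      ((measurable_append (𝒳 := 𝒳) l).comp measurable_prodMk_left)
  have h0 := nestedNorm_castSucc_rpow (κ := κ) (w := w) hm l x
  have h1 (c : ℝ≥0∞) : childLaplace m κ w K l c x =
    ∫⁻ y, expNeg (K * (c * nestedNorm m κ w l.succ (append l x y)) ^ extExp m l.succ) ∂(κ l x) :=
      rfl
  simp_rw [h1]
  set N : 𝒳 l → ℝ≥0∞ := fun y => nestedNorm m κ w l.succ (append l x y) with hN
  change ∫⁻ t, 1 - ∫⁻ y, expNeg (K * (s * ENNReal.ofReal t * N y) ^ extExp m l.succ) ∂(κ l x)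
    ∂(intensity (m l)) = _
  change _ = ∫⁻ y, N y ^ m l ∂(κ l x) at h0
  clear_value N
  have h2 (t : ℝ) : 1 - ∫⁻ y, expNeg (K * (s * ENNReal.ofReal t * N y) ^ extExp m l.succ) ∂(κ l x) =
      ∫⁻ y, 1 - expNeg (K * (s * N y * ENNReal.ofReal t) ^ extExp m l.succ) ∂(κ l x) := by
    rw [lintegral_sub (by fun_prop) (ne_top_of_le_ne_top ENNReal.one_ne_top
      ((lintegral_mono fun _ => expNeg_le_one _).trans (by simp)))
      (ae_of_all _ fun _ => expNeg_le_one _), lintegral_one, measure_univ]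
    simp_rw [mul_right_comm s _ (ENNReal.ofReal t)]
  have h3 : Measurable fun p : ℝ × 𝒳 l =>
      1 - expNeg (K * (s * N p.2 * ENNReal.ofReal p.1) ^ extExp m l.succ) := by fun_prop
  simp_rw [h2]
  rw [lintegral_lintegral_swap h3.aemeasurable]
  simp_rw [lintegral_one_sub_expNeg_mul (hm l) hm' hK0]
  rw [lintegral_mul_const _ (by fun_prop), ENNReal.mul_rpow_of_nonneg _ _ (hm l).le,
    h0, mul_comm]
  simp_rw [ENNReal.mul_rpow_of_nonneg _ _ (hm l).le]
  rw [lintegral_const_mul _ (by fun_prop)]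

lemma tendsto_lintegral_prod_expNeg [IsFiniteMeasure P] {ι : Type*} (S : Finset ι)
    {f : ι → ℕ → Ω → ℝ≥0∞} (hf : ∀ a n, Measurable (f a n)) :
    Tendsto (fun N => ∫⁻ ω, ∏ a ∈ S, ∏ n ∈ Finset.range N, expNeg (f a n ω) ∂P) atTop
      (𝓝 (∫⁻ ω, ∏ a ∈ S, expNeg (∑' n, f a n ω) ∂P)) := by
  refine tendsto_lintegral_of_dominated_convergence (fun _ => 1) (fun N => ?_) (fun N => ?_)
    (by simp) (ae_of_all _ fun ω => ?_)
  · exact Finset.measurable_prod _ fun a _ => Finset.measurable_prod _ fun n _ => (hf a n).expNeg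
  · exact ae_of_all _ fun ω => Finset.prod_le_one' fun a _ => Finset.prod_le_one' fun n _ =>
      expNeg_le_one _
  · simp_rw [← expNeg_sum]
    refine (expNeg_continuous.tendsto _).comp (tendsto_finsetSum _ fun a _ => ?_)
    exact ENNReal.summable.hasSum.tendsto_sum_nat

lemma IsCascade.lintegral_prod_expNeg_tsum [IsProbabilityMeasure P] (hm : ∀ l, 0 < m l)
    (hu : IsCascade P m u) (l : Fin k) (S : Finset (Fin l → ℕ)) {f : (Fin l → ℕ) → ℝ → ℝ≥0∞}
    (hf : ∀ a, Measurable (f a)) :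
    ∫⁻ ω, ∏ a ∈ S, expNeg (∑' n, f a (u l a n ω)) ∂P =
      ∏ a ∈ S, expNeg (∫⁻ t, 1 - expNeg (f a t) ∂(intensity (m l))) := by
  have hG (a : Fin l → ℕ) : Measurable fun v : ℕ → ℝ => expNeg (∑' n, f a (v n)) := by
    have := hf a
    fun_prop
  have h1 : iIndepFun (fun (a : Fin l → ℕ) (ω : Ω) (n : ℕ) => u l a n ω) P :=
    hu.indep.precomp (g := fun a : Fin l → ℕ => (⟨l, a⟩ : Σ l : Fin k, (Fin l → ℕ)))
      (fun a b h => by simpa using h)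
  have h2 := h1.comp (fun a v => expNeg (∑' n, f a (v n))) hG
  refine (lintegral_prod_eq_prod_lintegral_of_indepFun S _ h2 fun a =>
    (hG a).comp (measurable_pi_iff.2 fun n => (hu.poisson l a).measurable n)).trans ?_
  exact Finset.prod_congr rfl fun a _ => (hu.poisson l a).lintegral_expNeg_tsum (hm l) (hf a)

/-- The joint Laplace transform of the weights of the subtrees at the nodes of one level. -/
theorem exists_lintegral_prod_expNeg_subtreeSum [IsProbabilityMeasure P] (hm_mono : StrictMono m)
    (hm : ∀ l, 0 < m l) (hm1 : ∀ l, m l < 1) (hu : IsCascade P m u)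
    (hz : IsTreeProcess P (fun l x => κ l x) z)
    (huz : IndepFun (fun ω l a n => u l a n ω) (fun ω l a n => z l a n ω) P) (l : Fin (k + 1)) :
    ∃ K : ℝ≥0∞, K ≠ 0 ∧ K ≠ ∞ ∧ ∀ w : Prefix 𝒳 (Fin.last k) → ℝ≥0∞, Measurable w →
      ∀ (S : Finset (Fin l → ℕ)) (s : (Fin l → ℕ) → ℝ≥0∞),
      ∫⁻ ω, ∏ a ∈ S, expNeg (s a * subtreeSum (fun l a n => u l a n ω)
          (fun b => w (labels z (Fin.last k) b ω)) l a) ∂P =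
        ∫⁻ ω, ∏ a ∈ S, expNeg
          (K * (s a * nestedNorm m κ w l (labels z l a ω)) ^ extExp m l) ∂P := by
  classical
  induction l using Fin.reverseInduction with
  | last =>
    refine ⟨1, one_ne_zero, ENNReal.one_ne_top, fun w _ S s => ?_⟩
    simp only [subtreeSum_last, nestedNorm_last, extExp_last, ENNReal.rpow_one, one_mul]
  | cast l ih =>
    obtain ⟨K, hK0, hK, ih⟩ := ih
    have hm' := lt_extExp_succ hm_mono hm1 l
    -- The new constant involves only the exponents and the previous constant, not `w`. This
    -- uniformity is what later allows two weights to be compared.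
    refine ⟨tailConst (m l) (extExp m l.succ) K, tailConst_ne_zero ((hm l).trans hm') hK0,
      tailConst_ne_top (hm l) hm' hK, fun w hw S s => ?_⟩
    have hlab := fun l a => measurable_labels hz.measurable l a
    have hzm : Measurable fun ω l a n => z l a n ω :=
      measurable_pi_iff.2 fun l => measurable_pi_iff.2 fun a => measurable_pi_iff.2 fun n =>
        hz.measurable l a n
    have hum := hu.measurable
    set T : Ω → (Fin l.succ → ℕ) → ℝ≥0∞ := fun ω => subtreeSum (fun l a n => u l a n ω)
      (fun b => w (labels z (Fin.last k) b ω)) l.succ with hT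
    have hTm (b) : Measurable fun ω => T ω b := by
      refine (measurable_subtreeSum l.succ b).comp (hum.prodMk ?_)
      exact measurable_pi_iff.2 fun b => hw.comp (hlab _ b)
    set h : (Fin l → ℕ) → ℝ → Prefix 𝒳 l.castSucc → ℝ≥0∞ :=
      fun a t x => childLaplace m κ w K l (s a * ENNReal.ofReal t) x with hh
    have hhm (a) : Measurable fun p : ℝ × Prefix 𝒳 l.castSucc => h a p.1 p.2 :=
      (measurable_childLaplace hw K l).comp (by fun_prop :
        Measurable fun p : ℝ × Prefix 𝒳 l.castSucc => (s a * ENNReal.ofReal p.1, p.2))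
    -- the points of level `l` are integrated out last
    have step1 : ∫⁻ ω, ∏ a ∈ S, expNeg
        (s a * ∑' n, ENNReal.ofReal (u l a n ω) * T ω (child a n)) ∂P =
        ∫⁻ v : (Fin l → ℕ) → ℕ → ℝ, ∫⁻ ω, ∏ a ∈ S,
          expNeg (s a * ∑' n, ENNReal.ofReal (v a n) * T ω (child a n)) ∂P
          ∂(P.map fun ω a n => u l a n ω) := by
      have hlz (b) : Measurable fun ζ : (l : Fin k) → (Fin l → ℕ) → ℕ → 𝒳 l =>
          labels (fun l a n (ζ : (l : Fin k) → (Fin l → ℕ) → ℕ → 𝒳 l) => ζ l a n)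
            (Fin.last k) b ζ :=
        measurable_labels (fun l a n => by fun_prop) _ b
      have hG : Measurable fun p : ((Fin l → ℕ) → ℕ → ℝ) × ((l : Fin k) → (Fin l → ℕ) → ℕ → ℝ) ×
          ((l : Fin k) → (Fin l → ℕ) → ℕ → 𝒳 l) => ∏ a ∈ S, expNeg (s a * ∑' n,
          ENNReal.ofReal (p.1 a n) * subtreeSum p.2.1 (fun b => w (labels
            (fun l a n (ζ : (l : Fin k) → (Fin l → ℕ) → ℕ → 𝒳 l) => ζ l a n) (Fin.last k) b p.2.2))
            l.succ (child a n)) := by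
        refine Finset.measurable_prod _ fun a _ => Measurable.expNeg (Measurable.const_mul
          (Measurable.tsum fun n => Measurable.mul (by fun_prop) ?_) _)
        refine (measurable_subtreeSum l.succ (child a n)).comp
          ((measurable_fst.comp measurable_snd).prodMk (measurable_pi_iff.2 fun b => ?_))
        exact hw.comp ((hlz b).comp (measurable_snd.comp measurable_snd))
      have h1 := lintegral_comp_of_indepFun ((measurable_pi_apply l).comp hum)
        (((measurable_cut l).comp hum).prodMk hzm) (hu.indepFun_cut_labels hz.measurable huz l) hG
      simp only [Function.comp_def, subtreeSum_cut] at h1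
      exact h1
    -- With the points of level `l` frozen, the first `N` children of each node form a finite set of
    -- nodes on the next level. The induction hypothesis, with multipliers `s a * v a n`, and the
    -- conditional independence of labels apply to it; then `N` tends to infinity.
    have step2 (v : (Fin l → ℕ) → ℕ → ℝ) :
        ∫⁻ ω, ∏ a ∈ S, expNeg (s a * ∑' n, ENNReal.ofReal (v a n) * T ω (child a n)) ∂P =
        ∫⁻ ω, ∏ a ∈ S, expNeg (∑' n, negLog (h a (v a n) (labels z l.castSucc a ω))) ∂P := by
      have hfin (N : ℕ) : ∫⁻ ω, ∏ a ∈ S, ∏ n ∈ Finset.range N,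
            expNeg (s a * ENNReal.ofReal (v a n) * T ω (child a n)) ∂P =
          ∫⁻ ω, ∏ a ∈ S, ∏ n ∈ Finset.range N, h a (v a n) (labels z l.castSucc a ω) ∂P := by
        have h1 (p : (Fin l → ℕ) × ℕ) : Measurable fun x : Prefix 𝒳 l.castSucc × 𝒳 l =>
            nestedNorm m κ w l.succ (append l x.1 x.2) :=
          (measurable_nestedNorm hw _).comp (measurable_append l)
        have h2 := ih w hw ((S ×ˢ Finset.range N).map (childEquiv l).toEmbedding)
          (fun b => s ((childEquiv l).symm b).1 *
            ENNReal.ofReal (v ((childEquiv l).symm b).1 ((childEquiv l).symm b).2))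
        have h3 := hz.lintegral_prod l (fun p x => expNeg (K * (s p.1 * ENNReal.ofReal (v p.1 p.2) *
          nestedNorm m κ w l.succ (append l x.1 x.2)) ^ extExp m l.succ))
          (fun p => by have := h1 p; fun_prop) (fun p x => expNeg_le_one _) (S ×ˢ Finset.range N)
        simp only [append_labels] at h3
        simp only [Finset.prod_map, Equiv.coe_toEmbedding, Equiv.symm_apply_apply] at h2
        refine Eq.trans (lintegral_congr fun ω => ?_)
          ((h2.trans h3).trans (lintegral_congr fun ω => ?_))
        · exact (Finset.prod_product' S (Finset.range N) fun a n =>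
            expNeg (s a * ENNReal.ofReal (v a n) * T ω (child a n))).symm
        · exact Finset.prod_product' S (Finset.range N) fun a n =>
            h a (v a n) (labels z l.castSucc a ω)
      have ht1 := tendsto_lintegral_prod_expNeg (P := P) S
        (f := fun a n ω => s a * ENNReal.ofReal (v a n) * T ω (child a n))
        (fun a n => (hTm _).const_mul _)
      have ht2 := tendsto_lintegral_prod_expNeg (P := P) S
        (f := fun a n ω => negLog (h a (v a n) (labels z l.castSucc a ω)))
        (fun a n => Measurable.negLog ((hhm a).comp (measurable_const.prodMk (hlab _ a))))
      simp only [hfin] at ht1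
      simp only [expNeg_negLog (childLaplace_le_one _ _ _ _), hh] at ht2
      simp only [mul_assoc, ENNReal.tsum_mul_left] at ht1
      simp only [hh] at ht1 ⊢
      exact tendsto_nhds_unique ht1 ht2
    -- With the labels frozen instead, the processes attached to distinct nodes are independent, and
    -- each contributes its Laplace functional.
    have step3 (x : (Fin l → ℕ) → Prefix 𝒳 l.castSucc) :
        ∫⁻ v : (Fin l → ℕ) → ℕ → ℝ, ∏ a ∈ S, expNeg (∑' n, negLog (h a (v a n) (x a)))
          ∂(P.map fun ω a n => u l a n ω) =
        ∏ a ∈ S, expNeg (tailConst (m l) (extExp m l.succ) K *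
          (s a * nestedNorm m κ w l.castSucc (x a)) ^ m l) := by
      have h1 (a) : Measurable fun t => negLog (h a t (x a)) :=
        Measurable.negLog ((hhm a).comp (measurable_id.prodMk measurable_const))
      have h2 : Measurable fun v : (Fin l → ℕ) → ℕ → ℝ =>
          ∏ a ∈ S, expNeg (∑' n, negLog (h a (v a n) (x a))) := by
        refine Finset.measurable_prod _ fun a _ => Measurable.expNeg (Measurable.tsum fun n => ?_)
        exact (h1 a).comp (by fun_prop)
      have h3 : Measurable fun ω a n => u l a n ω := (measurable_pi_apply l).comp hum
      refine (lintegral_map h2 h3).trans ((hu.lintegral_prod_expNeg_tsum hm l S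
        (f := fun a t => negLog (h a t (x a))) h1).trans ?_)
      refine Finset.prod_congr rfl fun a _ => ?_
      simp only [hh, expNeg_negLog (childLaplace_le_one _ _ _ _)]
      rw [lintegral_one_sub_childLaplace hm hm' hw hK0]
    simp only [subtreeSum_castSucc, extExp_castSucc]
    rw [step1]
    simp_rw [step2]
    rw [lintegral_lintegral_swap]
    · exact lintegral_congr fun ω => step3 _
    · refine Measurable.aemeasurable ?_
      refine Finset.measurable_prod _ fun a _ => Measurable.expNeg (Measurable.tsum fun n => ?_)
      refine Measurable.negLog
        ((hhm a).comp (Measurable.prodMk ?_ ((hlab _ a).comp measurable_snd)))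
      exact (measurable_pi_apply n).comp ((measurable_pi_apply a).comp measurable_fst)

end

end

/-! ### The total weight seen from the root. -/

section

variable {k : ℕ} {𝒳 : Fin k → Type*} {Ω : Type*}

lemma trunc_succ (α : Fin k → ℕ) (l : Fin k) :
    trunc α l.succ = child (trunc α l.castSucc) (α l) := by
  funext i
  refine Fin.lastCases (n := l) ?_ (fun j => ?_) i
  · rw [child_last]; rfl
  · rw [child_castSucc]; rfl

instance uniquePrefixZero : Unique (Prefix 𝒳 0) where
  default := fun i => (show Fin 0 from i).elim0
  uniq _ := funext fun i => (show Fin 0 from i).elim0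

lemma tsum_succ_level (l : Fin k) (F : (Fin l.succ → ℕ) → ℝ≥0∞) :
    ∑' b, F b = ∑' a : Fin l.castSucc → ℕ, ∑' n, F (child a n) := by
  rw [← (childEquiv l).tsum_eq F, ENNReal.tsum_prod']
  rfl

/-- The product of the weights of the edges on the way from the root to a node. -/
noncomputable def edgeProd (v : (l : Fin k) → (Fin l → ℕ) → ℕ → Ω → ℝ) (l : Fin (k + 1))
    (a : Fin l → ℕ) (ω : Ω) : ℝ≥0∞ :=
  ∏ i : Fin l, ENNReal.ofReal (labels (𝒳 := fun _ => ℝ) v l a ω i)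

lemma edgeProd_child (v : (l : Fin k) → (Fin l → ℕ) → ℕ → Ω → ℝ) (l : Fin k)
    (a : Fin l.castSucc → ℕ) (n : ℕ) (ω : Ω) :
    edgeProd v l.succ (child a n) ω = edgeProd v l.castSucc a ω * ENNReal.ofReal (v l a n ω) := by
  unfold edgeProd
  rw [← append_labels]
  refine (Fin.prod_univ_castSucc (n := l) _).trans ?_
  simp only [append_castSucc, append_last]
  rfl

/-- Summing also over the single node of level `0` gives both sides the same shape, so that the
induction is uniform in `l`. -/
lemma subtreeSum_root (v : (l : Fin k) → (Fin l → ℕ) → ℕ → Ω → ℝ)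
    (g : (Fin (Fin.last k) → ℕ) → ℝ≥0∞) (l : Fin (k + 1)) (ω : Ω) :
    ∑' a, subtreeSum (fun l a n => v l a n ω) g 0 a =
      ∑' a, edgeProd v l a ω * subtreeSum (fun l a n => v l a n ω) g l a := by
  induction l using Fin.induction with
  | zero =>
    refine tsum_congr fun a => ?_
    have : edgeProd v 0 a ω = 1 := Fintype.prod_empty (ι := Fin 0) _
    rw [this, one_mul]
  | succ l ih =>
    rw [ih, tsum_succ_level]
    refine tsum_congr fun a => ?_
    rw [subtreeSum_castSucc, ← ENNReal.tsum_mul_left]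
    exact tsum_congr fun n => by rw [edgeProd_child, mul_assoc]

lemma edgeProd_last {u : (l : Fin k) → (Fin l → ℕ) → ℕ → Ω → ℝ} {ω : Ω}
    (h : ∀ l a n, 0 < u l a n ω) (α : Fin k → ℕ) :
    edgeProd u (Fin.last k) α ω = ENNReal.ofReal (weight u α ω) :=
  (ENNReal.ofReal_prod_of_nonneg fun _ _ => (h _ _ _).le).symm

variable [∀ l, MeasurableSpace (𝒳 l)] [MeasurableSpace Ω] {P : Measure Ω}
variable {m : Fin k → ℝ} {u : (l : Fin k) → (Fin l → ℕ) → ℕ → Ω → ℝ}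
  {z : (l : Fin k) → (Fin l → ℕ) → ℕ → Ω → 𝒳 l}

/-- The sum of the weights of the leaves, `w` being the weight of a label. -/
noncomputable def totalSum (u : (l : Fin k) → (Fin l → ℕ) → ℕ → Ω → ℝ)
    (z : (l : Fin k) → (Fin l → ℕ) → ℕ → Ω → 𝒳 l) (w : Prefix 𝒳 (Fin.last k) → ℝ≥0∞)
    (ω : Ω) : ℝ≥0∞ :=
  ∑' α : Fin k → ℕ, ENNReal.ofReal (weight u α ω) * w (branch z α ω)

lemma IsCascade.pos (hu : IsCascade P m u) : ∀ᵐ ω ∂P, ∀ l a n, 0 < u l a n ω := by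
  simp only [ae_all_iff]
  intro l a n
  filter_upwards [(hu.poisson l a).pos] with ω hω using hω n

lemma IsCascade.measurable_weight (hu : IsCascade P m u) (α : Fin k → ℕ) :
    Measurable (weight u α) :=
  Finset.measurable_prod _ fun _ _ => (hu.poisson _ _).measurable _

lemma measurable_branch (hz : ∀ l a n, Measurable (z l a n)) (α : Fin k → ℕ) :
    Measurable (branch z α) := measurable_labels hz _ _

lemma IsCascade.measurable_totalSum (hu : IsCascade P m u) (hz : ∀ l a n, Measurable (z l a n))
    {w : Prefix 𝒳 (Fin.last k) → ℝ≥0∞} (hw : Measurable w) : Measurable (totalSum u z w) :=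
  Measurable.tsum fun α => (hu.measurable_weight α).ennreal_ofReal.mul
    (hw.comp (measurable_branch hz α))

omit [∀ l, MeasurableSpace (𝒳 l)] [MeasurableSpace Ω] in
lemma subtreeSum_zero_eq_totalSum {ω : Ω} (h : ∀ l a n, 0 < u l a n ω)
    (w : Prefix 𝒳 (Fin.last k) → ℝ≥0∞) (a : Fin (0 : Fin (k + 1)) → ℕ) :
    subtreeSum (fun l a n => u l a n ω) (fun b => w (labels z (Fin.last k) b ω)) 0 a =
      totalSum u z w ω := by
  have h1 := subtreeSum_root u (fun b => w (labels z (Fin.last k) b ω)) (Fin.last k) ω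
  rw [tsum_eq_single a fun b hb =>
    absurd (funext fun i => (show Fin 0 from i).elim0) hb] at h1
  rw [h1, subtreeSum_last]
  exact tsum_congr fun α => by rw [edgeProd_last h]; rfl

variable {κ : (l : Fin k) → Kernel (Prefix 𝒳 l.castSucc) (𝒳 l)} [∀ l, IsMarkovKernel (κ l)]

/-- The Laplace transform of the total weight. -/
theorem exists_lintegral_expNeg_totalSum [IsProbabilityMeasure P] (hm_mono : StrictMono m)
    (hm : ∀ l, 0 < m l) (hm1 : ∀ l, m l < 1) (hu : IsCascade P m u)
    (hz : IsTreeProcess P (fun l x => κ l x) z)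
    (huz : IndepFun (fun ω l a n => u l a n ω) (fun ω l a n => z l a n ω) P) :
    ∃ (K : ℝ≥0∞) (θ : ℝ), K ≠ 0 ∧ K ≠ ∞ ∧ 0 < θ ∧ ∀ w : Prefix 𝒳 (Fin.last k) → ℝ≥0∞, Measurable w →
      ∀ s : ℝ≥0∞, ∫⁻ ω, expNeg (s * totalSum u z w ω) ∂P =
        expNeg (K * (s * nestedNorm m κ w 0 default) ^ θ) := by
  obtain ⟨K, hK0, hK, h⟩ :=
    exists_lintegral_prod_expNeg_subtreeSum hm_mono hm hm1 hu hz huz (0 : Fin (k + 1))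
  refine ⟨K, extExp m 0, hK0, hK, extExp_pos hm 0, fun w hw s => ?_⟩
  have a : Fin (0 : Fin (k + 1)) → ℕ := fun _ => 0
  have h1 := h w hw {a} (fun _ => s)
  simp only [Finset.prod_singleton] at h1
  have h2 (ω : Ω) : labels z 0 a ω = default := Subsingleton.elim _ _
  simp only [h2, lintegral_const, measure_univ, mul_one] at h1
  rw [← h1]
  refine lintegral_congr_ae ?_
  filter_upwards [hu.pos] with ω hω
  rw [subtreeSum_zero_eq_totalSum hω]

end

/-! ### The reweighted law of a branch. -/

section

variable {k : ℕ} {𝒳 : Fin k → Type*} {Ω : Type*}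
variable [∀ l, MeasurableSpace (𝒳 l)] [MeasurableSpace Ω] {P : Measure Ω}
variable {m : Fin k → ℝ} {z : (l : Fin k) → (Fin l → ℕ) → ℕ → Ω → 𝒳 l}
variable {κ : (l : Fin k) → Kernel (Prefix 𝒳 l.castSucc) (𝒳 l)} [∀ l, IsMarkovKernel (κ l)]
variable {X : Prefix 𝒳 (Fin.last k) → ℝ}

lemma measurable_level (hX : Measurable X) (l : Fin (k + 1)) :
    Measurable (level m (fun l x => κ l x) X l) := by
  induction l using Fin.reverseInduction with
  | last => rwa [level_last]
  | cast l ih =>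
    rw [funext fun x => level_castSucc m (fun l x => κ l x) X l x]
    refine (Real.measurable_log.comp ?_).const_mul _
    have h : Measurable fun p : Prefix 𝒳 l.castSucc × 𝒳 l =>
      Real.exp (m l * level m (fun l x => κ l x) X l.succ (append l p.1 p.2)) :=
        Real.measurable_exp.comp ((ih.comp (measurable_append l)).const_mul _)
    exact (h.stronglyMeasurable.integral_kernel_prod_right' (κ := κ l)).measurable

lemma measurable_stepDensity (hX : Measurable X) (l : Fin k) :
    Measurable fun p : Prefix 𝒳 l.castSucc × 𝒳 l =>
      stepDensity m (fun l x => κ l x) X l p.1 p.2 :=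
  Real.measurable_exp.comp ((((measurable_level hX _).comp (measurable_append l)).sub
    ((measurable_level hX _).comp measurable_fst)).const_mul _)

lemma measurable_ofReal_stepDensity (hX : Measurable X) (l : Fin k) (x : Prefix 𝒳 l.castSucc) :
    Measurable fun y => ENNReal.ofReal (stepDensity m (fun l x => κ l x) X l x y) :=
  ((measurable_stepDensity hX l).comp measurable_prodMk_left).ennreal_ofReal

lemma Measurable.comp_append {l : Fin k} {f : Prefix 𝒳 l.succ → ℝ≥0∞} (hf : Measurable f)
    (x : Prefix 𝒳 l.castSucc) : Measurable fun y => f (append l x y) :=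
  hf.comp ((measurable_append l).comp measurable_prodMk_left)

/-- The conditional expectations, under the reweighted law, of a function of the labels of a
branch. -/
noncomputable def tiltedExp (m : Fin k → ℝ) (κ : (l : Fin k) → Kernel (Prefix 𝒳 l.castSucc) (𝒳 l))
    (X : Prefix 𝒳 (Fin.last k) → ℝ) (f : Prefix 𝒳 (Fin.last k) → ℝ≥0∞) (l : Fin (k + 1)) :
    Prefix 𝒳 l → ℝ≥0∞ :=
  Fin.reverseInduction (motive := fun l => Prefix 𝒳 l → ℝ≥0∞) f
    (fun l F x => ∫⁻ y, ENNReal.ofReal (stepDensity m (fun l x => κ l x) X l x y) *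
      F (append l x y) ∂(κ l x)) l

omit [∀ l, IsMarkovKernel (κ l)] in
lemma tiltedExp_last (f : Prefix 𝒳 (Fin.last k) → ℝ≥0∞) :
    tiltedExp m κ X f (Fin.last k) = f := by
  simp [tiltedExp]

omit [∀ l, IsMarkovKernel (κ l)] in
lemma tiltedExp_castSucc (f : Prefix 𝒳 (Fin.last k) → ℝ≥0∞) (l : Fin k)
    (x : Prefix 𝒳 l.castSucc) :
    tiltedExp m κ X f l.castSucc x =
      ∫⁻ y, ENNReal.ofReal (stepDensity m (fun l x => κ l x) X l x y) *
        tiltedExp m κ X f l.succ (append l x y) ∂(κ l x) := by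
  simp [tiltedExp]

lemma measurable_tiltedExp (hX : Measurable X) {f : Prefix 𝒳 (Fin.last k) → ℝ≥0∞}
    (hf : Measurable f) (l : Fin (k + 1)) : Measurable (tiltedExp m κ X f l) := by
  induction l using Fin.reverseInduction with
  | last => rwa [tiltedExp_last]
  | cast l ih =>
    rw [funext fun x => tiltedExp_castSucc (m := m) (κ := κ) (X := X) f l x]
    exact ((measurable_stepDensity hX l).ennreal_ofReal.mul
      (ih.comp (measurable_append l))).lintegral_kernel_prod_right'

/-- The reweighted conditional distributions as kernels. -/
noncomputable def tiltedKernel (m : Fin k → ℝ)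
    (κ : (l : Fin k) → Kernel (Prefix 𝒳 l.castSucc) (𝒳 l)) [∀ l, IsMarkovKernel (κ l)]
    (X : Prefix 𝒳 (Fin.last k) → ℝ) (l : Fin k) : Kernel (Prefix 𝒳 l.castSucc) (𝒳 l) :=
  (κ l).withDensity fun x y => ENNReal.ofReal (stepDensity m (fun l x => κ l x) X l x y)

/-- Only s-finiteness can be expected: where the integral or the logarithm in `level` takes a
default value, the densities need not integrate to `1`. -/
instance (l : Fin k) : IsSFiniteKernel (tiltedKernel m κ X l) :=
  Kernel.IsSFiniteKernel.withDensity _ fun _ _ => ENNReal.ofReal_ne_top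

lemma tiltedKernel_apply (hX : Measurable X) (l : Fin k) (x : Prefix 𝒳 l.castSucc) :
    tiltedKernel m κ X l x = reweighted m (fun l x => κ l x) X l x := by
  rw [tiltedKernel, Kernel.withDensity_apply _ (measurable_stepDensity hX l).ennreal_ofReal]
  rfl

/-- The law of a branch under the reweighted law. -/
lemma IsTreeProcess.lintegral_branch_reweighted [IsProbabilityMeasure P] (hX : Measurable X)
    (hz : IsTreeProcess P (reweighted m (fun l x => κ l x) X) z)
    {f : Prefix 𝒳 (Fin.last k) → ℝ≥0∞} (hf : Measurable f) (α : Fin k → ℕ) :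
    ∫⁻ ω, f (branch z α ω) ∂P = tiltedExp m κ X f 0 default := by
  have hz' : IsTreeProcess P (fun l x => tiltedKernel m κ X l x) z := by
    simp only [tiltedKernel_apply hX]
    exact hz
  have key (l : Fin (k + 1)) : ∫⁻ ω, f (branch z α ω) ∂P =
      ∫⁻ ω, tiltedExp m κ X f l (labels z l (trunc α l) ω) ∂P := by
    induction l using Fin.reverseInduction with
    | last => rw [tiltedExp_last]; rfl
    | cast l ih =>
      rw [ih, trunc_succ, hz'.lintegral_labels l _ _ (measurable_tiltedExp hX hf l.succ)]
      refine lintegral_congr fun ω => ?_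
      rw [tiltedExp_castSucc, tiltedKernel_apply hX, reweighted]
      exact lintegral_withDensity_eq_lintegral_mul _ (measurable_ofReal_stepDensity hX l _)
        ((measurable_tiltedExp hX hf l.succ).comp_append _)
  rw [key 0]
  have h (ω : Ω) : labels z 0 (trunc α 0) ω = default := Subsingleton.elim _ _
  simp [h]

/-- The product of the densities along a prefix. -/
noncomputable def prefixDensity (m : Fin k → ℝ)
    (κ : (l : Fin k) → Kernel (Prefix 𝒳 l.castSucc) (𝒳 l)) (X : Prefix 𝒳 (Fin.last k) → ℝ)
    (l : Fin (k + 1)) (x : Prefix 𝒳 l) : ℝ≥0∞ :=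
  ∏ i : Fin l, ENNReal.ofReal (stepDensity m (fun l x => κ l x) X
    (i.castLE (Nat.le_of_lt_succ l.isLt)) (fun j : Fin i => x (j.castLE i.isLt.le)) (x i))

lemma measurable_prefixDensity (hX : Measurable X) (l : Fin (k + 1)) :
    Measurable (prefixDensity m κ X l) := by
  refine Finset.measurable_prod _ fun i _ => ?_
  have h1 : Measurable fun x : Prefix 𝒳 l => (fun j : Fin i => x (j.castLE i.isLt.le) :
      Prefix 𝒳 (i.castLE (Nat.le_of_lt_succ l.isLt)).castSucc) :=
    measurable_pi_iff.2 fun j => measurable_pi_apply (j.castLE i.isLt.le : Fin l)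
  exact ((measurable_stepDensity hX (i.castLE (Nat.le_of_lt_succ l.isLt))).comp
    (h1.prodMk (measurable_pi_apply i))).ennreal_ofReal

omit [∀ l, IsMarkovKernel (κ l)] in
lemma prefixDensity_append (l : Fin k) (x : Prefix 𝒳 l.castSucc) (y : 𝒳 l) :
    prefixDensity m κ X l.succ (append l x y) = prefixDensity m κ X l.castSucc x *
      ENNReal.ofReal (stepDensity m (fun l x => κ l x) X l x y) := by
  unfold prefixDensity
  refine (Fin.prod_univ_castSucc (n := l) _).trans ?_
  rw [append_last]
  congr 1
  · refine Finset.prod_congr rfl fun i _ => ?_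
    rw [append_castSucc]
    have h1 : (fun j : Fin i => append l x y (Fin.castSucc (j.castLE i.isLt.le) : Fin (l + 1))) =
      fun j : Fin i => x (j.castLE i.isLt.le) := funext fun j => append_castSucc l x y _
    exact congrArg (fun t => ENNReal.ofReal (stepDensity m (fun l x => κ l x) X
      (i.castLE l.isLt.le) t (x i))) h1
  · have h1 : (fun j : Fin l => append l x y (Fin.castSucc j : Fin (l + 1))) = x :=
      funext fun j => append_castSucc l x y j
    exact congrArg (fun t => ENNReal.ofReal (stepDensity m (fun l x => κ l x) X l t y)) h1

omit [MeasurableSpace Ω] [∀ l, IsMarkovKernel (κ l)] in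
lemma prefixDensity_branch (α : Fin k → ℕ) (ω : Ω) :
    prefixDensity m κ X (Fin.last k) (branch z α ω) =
      ENNReal.ofReal (branchDensity m (fun l x => κ l x) X z α ω) :=
  (ENNReal.ofReal_prod_of_nonneg fun _ _ => (Real.exp_pos _).le).symm

/-- The expectation of a function of the labels of a branch, weighted by the product of the
densities. -/
lemma IsTreeProcess.lintegral_branchDensity_mul [IsProbabilityMeasure P] (hX : Measurable X)
    (hz : IsTreeProcess P (fun l x => κ l x) z)
    {f : Prefix 𝒳 (Fin.last k) → ℝ≥0∞} (hf : Measurable f) (α : Fin k → ℕ) :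
    ∫⁻ ω, ENNReal.ofReal (branchDensity m (fun l x => κ l x) X z α ω) * f (branch z α ω) ∂P =
      tiltedExp m κ X f 0 default := by
  -- The right-hand side interpolates: at the last level all densities sit in the product, at level
  -- `0` all have been integrated into `tiltedExp`.
  have key (l : Fin (k + 1)) :
      ∫⁻ ω, ENNReal.ofReal (branchDensity m (fun l x => κ l x) X z α ω) * f (branch z α ω) ∂P =
      ∫⁻ ω, prefixDensity m κ X l (labels z l (trunc α l) ω) *
        tiltedExp m κ X f l (labels z l (trunc α l) ω) ∂P := by
    induction l using Fin.reverseInduction with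
    | last =>
      rw [tiltedExp_last]
      simp_rw [← prefixDensity_branch]
      rfl
    | cast l ih =>
      rw [ih, trunc_succ, hz.lintegral_labels l _ _
        (f := fun x => prefixDensity m κ X l.succ x * tiltedExp m κ X f l.succ x)
        ((measurable_prefixDensity hX _).mul (measurable_tiltedExp hX hf l.succ))]
      refine lintegral_congr fun ω => ?_
      simp_rw [tiltedExp_castSucc, prefixDensity_append, mul_assoc]
      rw [lintegral_const_mul]
      exact (measurable_ofReal_stepDensity hX l _).mul
        ((measurable_tiltedExp hX hf l.succ).comp_append _)
  rw [key 0]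
  have h (ω : Ω) : labels z 0 (trunc α 0) ω = default := Subsingleton.elim _ _
  have h' : prefixDensity m κ X 0 (default : Prefix 𝒳 0) = 1 := Fintype.prod_empty (ι := Fin 0) _
  simp [h, h']

/-! ### Nested norms -/

variable {w : Prefix 𝒳 (Fin.last k) → ℝ≥0∞}

/-- Jensen's inequality for a concave power, taken from the monotonicity of `L^p` norms on a
probability space. -/
lemma lintegral_rpow_le {α : Type*} [MeasurableSpace α] {μ : Measure α} [IsProbabilityMeasure μ]
    {f : α → ℝ≥0∞} (hf : Measurable f) {p : ℝ} (hp : 0 < p) (hp1 : p ≤ 1) :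
    ∫⁻ x, f x ^ p ∂μ ≤ (∫⁻ x, f x ∂μ) ^ p := by
  have h := eLpNorm'_le_eLpNorm'_of_exponent_le hp hp1 μ hf.aestronglyMeasurable
  simp only [eLpNorm', enorm_eq_self, ENNReal.rpow_one, div_one] at h
  have h2 := ENNReal.rpow_le_rpow h hp.le
  rwa [← ENNReal.rpow_mul, one_div_mul_cancel hp.ne', ENNReal.rpow_one] at h2

lemma nestedNorm_ne_zero (hm : ∀ l, 0 < m l) (hw : Measurable w) (hw0 : ∀ x, w x ≠ 0)
    (l : Fin (k + 1)) (x : Prefix 𝒳 l) : nestedNorm m κ w l x ≠ 0 := by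
  induction l using Fin.reverseInduction with
  | last => rw [nestedNorm_last]; exact hw0 x
  | cast l ih =>
    have hmeas : Measurable fun y => nestedNorm m κ w l.succ (append l x y) ^ m l :=
      ((measurable_nestedNorm hw _).comp_append x).pow_const _
    rw [nestedNorm_castSucc, Ne, ENNReal.rpow_eq_zero_iff_of_pos (by have := hm l; positivity),
      lintegral_eq_zero_iff hmeas]
    intro h
    have : ∀ᵐ y ∂(κ l x), False := by
      filter_upwards [h] with y hy
      exact ih _ ((ENNReal.rpow_eq_zero_iff_of_pos (hm l)).1 hy)
    simp [IsProbabilityMeasure.ne_zero] at this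

lemma nestedNorm_castSucc_le (hm : ∀ l, 0 < m l) (hm1 : ∀ l, m l < 1) (hw : Measurable w)
    (l : Fin k) (x : Prefix 𝒳 l.castSucc) :
    nestedNorm m κ w l.castSucc x ≤ ∫⁻ y, nestedNorm m κ w l.succ (append l x y) ∂(κ l x) := by
  have hmeas : Measurable fun y => nestedNorm m κ w l.succ (append l x y) :=
    (measurable_nestedNorm hw _).comp_append x
  rw [← ENNReal.rpow_le_rpow_iff (hm l), nestedNorm_castSucc_rpow hm]
  exact lintegral_rpow_le hmeas (hm l) (hm1 l).le

/-- By Jensen each norm is at most a conditional mean of the norm one level further from the root,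
so integrability of `exp X` spreads to all levels. -/
lemma IsTreeProcess.lintegral_nestedNorm_ne_top [IsProbabilityMeasure P] (hm : ∀ l, 0 < m l)
    (hm1 : ∀ l, m l < 1) (hz : IsTreeProcess P (fun l x => κ l x) z) (hw : Measurable w)
    (h : ∀ α, ∫⁻ ω, w (branch z α ω) ∂P ≠ ∞) (l : Fin (k + 1)) (a : Fin l → ℕ) :
    ∫⁻ ω, nestedNorm m κ w l (labels z l a ω) ∂P ≠ ∞ := by
  induction l using Fin.reverseInduction with
  | last => rw [nestedNorm_last]; exact h a
  | cast l ih =>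
    refine ne_top_of_le_ne_top (ih (child a 0)) ?_
    rw [hz.lintegral_labels l a 0 (measurable_nestedNorm hw _)]
    exact lintegral_mono fun ω => nestedNorm_castSucc_le hm hm1 hw l _

end

/-! ### Step densities as ratios of nested norms, and the Jensen bound at the root. -/

section

variable {k : ℕ} {𝒳 : Fin k → Type*} {Ω : Type*}
variable [∀ l, MeasurableSpace (𝒳 l)] [MeasurableSpace Ω] {P : Measure Ω}
variable {m : Fin k → ℝ} {z : (l : Fin k) → (Fin l → ℕ) → ℕ → Ω → 𝒳 l}
variable {κ : (l : Fin k) → Kernel (Prefix 𝒳 l.castSucc) (𝒳 l)} [∀ l, IsMarkovKernel (κ l)]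
variable {X : Prefix 𝒳 (Fin.last k) → ℝ}

/-- The weights `exp X` as a function with values in `[0, ∞]`. -/
noncomputable def expWeight (X : Prefix 𝒳 (Fin.last k) → ℝ) (x : Prefix 𝒳 (Fin.last k)) : ℝ≥0∞ :=
  ENNReal.ofReal (Real.exp (X x))

omit [∀ l, MeasurableSpace (𝒳 l)] in
lemma expWeight_ne_zero (x : Prefix 𝒳 (Fin.last k)) : expWeight X x ≠ 0 := by
  simp [expWeight, Real.exp_pos]

lemma measurable_expWeight (hX : Measurable X) : Measurable (expWeight X) :=
  (Real.measurable_exp.comp hX).ennreal_ofReal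

/-- `level` is built from a real integral and a real logarithm. Finiteness of the norm gives
integrability, and its positivity makes `exp` undo `log`, so no default value occurs. -/
lemma nestedNorm_castSucc_eq (hm : ∀ l, 0 < m l) (hX : Measurable X) (l : Fin k)
    (x : Prefix 𝒳 l.castSucc) (hx : nestedNorm m κ (expWeight X) l.castSucc x ≠ ∞)
    (h : ∀ᵐ y ∂(κ l x), nestedNorm m κ (expWeight X) l.succ (append l x y) =
      ENNReal.ofReal (Real.exp (level m (fun l x => κ l x) X l.succ (append l x y)))) :
    nestedNorm m κ (expWeight X) l.castSucc x =
      ENNReal.ofReal (Real.exp (level m (fun l x => κ l x) X l.castSucc x)) := by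
  set F : 𝒳 l → ℝ := fun y => Real.exp (m l * level m (fun l x => κ l x) X l.succ (append l x y))
    with hF
  have hFm : Measurable F := Real.measurable_exp.comp (((measurable_level hX _).comp
    ((measurable_append l).comp measurable_prodMk_left)).const_mul _)
  have h1 : nestedNorm m κ (expWeight X) l.castSucc x ^ m l = ∫⁻ y, ENNReal.ofReal
      (F y) ∂(κ l x) := by
    rw [nestedNorm_castSucc_rpow hm]
    refine lintegral_congr_ae ?_
    filter_upwards [h] with y hy
    rw [hy, ENNReal.ofReal_rpow_of_pos (Real.exp_pos _), ← Real.exp_mul, mul_comm]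
  have hfin : ∫⁻ y, ENNReal.ofReal (F y) ∂(κ l x) ≠ ∞ := by
    rw [← h1]
    exact ENNReal.rpow_ne_top_of_nonneg (hm l).le hx
  have hint : Integrable F (κ l x) :=
    (lintegral_ofReal_ne_top_iff_integrable hFm.aestronglyMeasurable
      (ae_of_all _ fun _ => (Real.exp_pos _).le)).1 hfin
  rw [← ofReal_integral_eq_lintegral_ofReal hint (ae_of_all _ fun _ => (Real.exp_pos _).le)] at h1
  have hpos : 0 < ∫ y, F y ∂(κ l x) := by
    rw [← ENNReal.ofReal_pos, ← h1]
    exact ENNReal.rpow_pos_of_nonneg (pos_iff_ne_zero.2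
      (nestedNorm_ne_zero hm (measurable_expWeight hX) expWeight_ne_zero _ _)) (hm l).le
  rw [level_castSucc, ← (ENNReal.rpow_left_injective (hm l).ne').eq_iff, h1,
    ENNReal.ofReal_rpow_of_pos (Real.exp_pos _), ← Real.exp_mul, mul_comm, ← mul_assoc,
    mul_one_div_cancel (hm l).ne', one_mul, Real.exp_log hpos]

-- The density is the `m l`-th power of the ratio of two successive norms; the product form avoids
-- division in `[0, ∞]`.
omit [∀ l, IsMarkovKernel (κ l)] in
lemma ofReal_stepDensity_mul (l : Fin k) (x : Prefix 𝒳 l.castSucc) (y : 𝒳 l)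
    (hx : nestedNorm m κ (expWeight X) l.castSucc x =
      ENNReal.ofReal (Real.exp (level m (fun l x => κ l x) X l.castSucc x)))
    (hy : nestedNorm m κ (expWeight X) l.succ (append l x y) =
      ENNReal.ofReal (Real.exp (level m (fun l x => κ l x) X l.succ (append l x y)))) :
    nestedNorm m κ (expWeight X) l.castSucc x ^ m l *
      ENNReal.ofReal (stepDensity m (fun l x => κ l x) X l x y) =
      nestedNorm m κ (expWeight X) l.succ (append l x y) ^ m l := by
  rw [hx, hy, ENNReal.ofReal_rpow_of_pos (Real.exp_pos _),
    ENNReal.ofReal_rpow_of_pos (Real.exp_pos _), ← ENNReal.ofReal_mul (by positivity), stepDensity,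
    ← Real.exp_mul, ← Real.exp_mul, ← Real.exp_add]
  ring_nf

section
variable [IsProbabilityMeasure P]

lemma IsTreeProcess.ae_nestedNorm_eq (hm : ∀ l, 0 < m l)
    (hm1 : ∀ l, m l < 1) (hz : IsTreeProcess P (fun l x => κ l x) z) (hX : Measurable X)
    (h : ∀ α, ∫⁻ ω, expWeight X (branch z α ω) ∂P ≠ ∞) (l : Fin (k + 1)) (a : Fin l → ℕ) :
    ∀ᵐ ω ∂P, nestedNorm m κ (expWeight X) l (labels z l a ω) =
      ENNReal.ofReal (Real.exp (level m (fun l x => κ l x) X l (labels z l a ω))) := by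
  have hw := measurable_expWeight hX
  induction l using Fin.reverseInduction with
  | last => rw [nestedNorm_last, level_last]; exact ae_of_all _ fun ω => rfl
  | cast l ih =>
    have h1 := hz.lintegral_nestedNorm_ne_top hm hm1 hw h l.castSucc a
    have h2 := ae_lt_top
        ((measurable_nestedNorm hw _).comp (measurable_labels hz.measurable _ a)) h1
    have h3 := hz.ae_labels l a 0 (s := {x | nestedNorm m κ (expWeight X) l.succ x =
      ENNReal.ofReal (Real.exp (level m (fun l x => κ l x) X l.succ x))})
      (measurableSet_eq_fun (measurable_nestedNorm hw _)
        (Real.measurable_exp.comp (measurable_level hX _)).ennreal_ofReal) (ih _)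
    filter_upwards [h2, h3] with ω h2 h3
    exact nestedNorm_castSucc_eq hm hX l _ h2.ne h3

/-- Almost surely, the step densities are the ratios of the nested norms, and their integrals are
equal to `1`. -/
lemma IsTreeProcess.ae_stepDensity (hm : ∀ l, 0 < m l)
    (hm1 : ∀ l, m l < 1) (hz : IsTreeProcess P (fun l x => κ l x) z) (hX : Measurable X)
    (h : ∀ α, ∫⁻ ω, expWeight X (branch z α ω) ∂P ≠ ∞) (l : Fin k) (a : Fin l.castSucc → ℕ) :
    ∀ᵐ ω ∂P, (∀ᵐ y ∂(κ l (labels z l.castSucc a ω)),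
      nestedNorm m κ (expWeight X) l.castSucc (labels z l.castSucc a ω) ^ m l *
        ENNReal.ofReal (stepDensity m (fun l x => κ l x) X l (labels z l.castSucc a ω) y) =
      nestedNorm m κ (expWeight X) l.succ (append l (labels z l.castSucc a ω) y) ^ m l) ∧
      ∫⁻ y, ENNReal.ofReal (stepDensity m (fun l x => κ l x) X l (labels z l.castSucc a ω) y)
        ∂(κ l (labels z l.castSucc a ω)) = 1 := by
  have hw := measurable_expWeight hX
  have h2 := hz.ae_nestedNorm_eq hm hm1 hX h l.castSucc a
  have h3 := hz.ae_labels l a 0 (s := {x | nestedNorm m κ (expWeight X) l.succ x =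
      ENNReal.ofReal (Real.exp (level m (fun l x => κ l x) X l.succ x))})
      (measurableSet_eq_fun (measurable_nestedNorm hw _)
        (Real.measurable_exp.comp (measurable_level hX _)).ennreal_ofReal)
      (hz.ae_nestedNorm_eq hm hm1 hX h l.succ (child a 0))
  filter_upwards [h2, h3] with ω h2 h3
  have h4 : ∀ᵐ y ∂(κ l (labels z l.castSucc a ω)),
      nestedNorm m κ (expWeight X) l.castSucc (labels z l.castSucc a ω) ^ m l *
        ENNReal.ofReal (stepDensity m (fun l x => κ l x) X l (labels z l.castSucc a ω) y) =
      nestedNorm m κ (expWeight X) l.succ (append l (labels z l.castSucc a ω) y) ^ m l := by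
    filter_upwards [h3] with y hy using ofReal_stepDensity_mul l _ y h2 hy
  refine ⟨h4, ?_⟩
  have h5 := lintegral_congr_ae h4
  rw [lintegral_const_mul _ (measurable_ofReal_stepDensity hX l _), ← nestedNorm_castSucc_rpow hm]
    at h5
  have h6 : nestedNorm m κ (expWeight X) l.castSucc (labels z l.castSucc a ω) ^ m l ≠ 0 := by
    rw [Ne, ENNReal.rpow_eq_zero_iff_of_pos (hm l)]
    exact nestedNorm_ne_zero hm hw expWeight_ne_zero _ _
  have h7 : nestedNorm m κ (expWeight X) l.castSucc (labels z l.castSucc a ω) ^ m l ≠ ∞ :=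
    ENNReal.rpow_ne_top_of_nonneg (hm l).le (by rw [h2]; exact ENNReal.ofReal_ne_top)
  exact (ENNReal.mul_eq_left h6 h7).1 h5

lemma IsTreeProcess.tiltedExp_one (hm : ∀ l, 0 < m l)
    (hm1 : ∀ l, m l < 1) (hz : IsTreeProcess P (fun l x => κ l x) z) (hX : Measurable X)
    (h : ∀ α, ∫⁻ ω, expWeight X (branch z α ω) ∂P ≠ ∞) :
    tiltedExp m κ X 1 0 default = 1 := by
  have key (l : Fin (k + 1)) (a : Fin l → ℕ) :
      ∀ᵐ ω ∂P, tiltedExp m κ X 1 l (labels z l a ω) = 1 := by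
    induction l using Fin.reverseInduction with
    | last => rw [tiltedExp_last]; exact ae_of_all _ fun ω => rfl
    | cast l ih =>
      have h3 := hz.ae_labels l a 0 (s := {x | tiltedExp m κ X 1 l.succ x = 1})
        (measurableSet_eq_fun (measurable_tiltedExp hX measurable_one _) measurable_const) (ih _)
      filter_upwards [h3, hz.ae_stepDensity hm hm1 hX h l a] with ω h3 h4
      rw [tiltedExp_castSucc, ← h4.2]
      refine lintegral_congr_ae ?_
      filter_upwards [h3] with y hy
      rw [show tiltedExp m κ X 1 l.succ (append l (labels z l.castSucc a ω) y) = 1 from hy, mul_one]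
  -- At the root there are no labels, so an almost sure statement about a constant is simply true.
  obtain ⟨ω, hω⟩ := (key 0 fun _ => 0).exists
  rwa [Subsingleton.elim (labels z 0 _ ω) default] at hω

/-- Changing the weights at the leaves by a factor `f` changes the norm at the root by a factor of
at most the reweighted expectation of `f`. -/
lemma IsTreeProcess.nestedNorm_mul_le (hm : ∀ l, 0 < m l)
    (hm1 : ∀ l, m l < 1) (hz : IsTreeProcess P (fun l x => κ l x) z) (hX : Measurable X)
    (h : ∀ α, ∫⁻ ω, expWeight X (branch z α ω) ∂P ≠ ∞)
    {f : Prefix 𝒳 (Fin.last k) → ℝ≥0∞} (hf : Measurable f) :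
    nestedNorm m κ (fun x => expWeight X x * f x) 0 default ≤
      nestedNorm m κ (expWeight X) 0 default * tiltedExp m κ X f 0 default := by
  have hw := measurable_expWeight hX
  have key (l : Fin (k + 1)) (a : Fin l → ℕ) :
      ∀ᵐ ω ∂P, nestedNorm m κ (fun x => expWeight X x * f x) l (labels z l a ω) ≤
        nestedNorm m κ (expWeight X) l (labels z l a ω) * tiltedExp m κ X f l (labels z l a ω) := by
    induction l using Fin.reverseInduction with
    | last => simp only [nestedNorm_last, tiltedExp_last]; exact ae_of_all _ fun ω => le_rfl
    | cast l ih =>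
      have h3 := hz.ae_labels l a 0
        (s := {x | nestedNorm m κ (fun x => expWeight X x * f x) l.succ x ≤
          nestedNorm m κ (expWeight X) l.succ x * tiltedExp m κ X f l.succ x})
        (measurableSet_le (measurable_nestedNorm (hw.mul hf) _)
          ((measurable_nestedNorm hw _).mul (measurable_tiltedExp hX hf _))) (ih _)
      filter_upwards [h3, hz.ae_stepDensity hm hm1 hX h l a] with ω h3 h4
      set x := labels z l.castSucc a ω
      have hRm : Measurable fun y => tiltedExp m κ X f l.succ (append l x y) :=
        (measurable_tiltedExp hX hf _).comp_append x
      have hWm := measurable_ofReal_stepDensity (m := m) (κ := κ) hX l x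
      rw [← ENNReal.rpow_le_rpow_iff (hm l), nestedNorm_castSucc_rpow hm]
      -- The power of the old norm of the child splits into that of the parent times the density.
      -- What remains is the mean of an `m l`-th power under the tilted measure, which almost surely
      -- has mass one, so Jensen applies.
      calc ∫⁻ y, nestedNorm m κ (fun x => expWeight X x * f x) l.succ (append l x y) ^ m l ∂(κ l x)
          ≤ ∫⁻ y, nestedNorm m κ (expWeight X) l.castSucc x ^ m l *
            (ENNReal.ofReal (stepDensity m (fun l x => κ l x) X l x y) *
              tiltedExp m κ X f l.succ (append l x y) ^ m l) ∂(κ l x) := by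
            refine lintegral_mono_ae ?_
            filter_upwards [h3, h4.1] with y hy hy'
            rw [← mul_assoc, hy', ← ENNReal.mul_rpow_of_nonneg _ _ (hm l).le]
            exact ENNReal.rpow_le_rpow hy (hm l).le
        _ = nestedNorm m κ (expWeight X) l.castSucc x ^ m l *
            ∫⁻ y, tiltedExp m κ X f l.succ (append l x y) ^ m l ∂((κ l x).withDensity fun y =>
              ENNReal.ofReal (stepDensity m (fun l x => κ l x) X l x y)) := by
            rw [lintegral_withDensity_eq_lintegral_mul _ hWm (hRm.pow_const _)]
            exact lintegral_const_mul _ (hWm.mul (hRm.pow_const _))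
        _ ≤ nestedNorm m κ (expWeight X) l.castSucc x ^ m l *
            (∫⁻ y, tiltedExp m κ X f l.succ (append l x y) ∂((κ l x).withDensity fun y =>
              ENNReal.ofReal (stepDensity m (fun l x => κ l x) X l x y))) ^ m l := by
            have : IsProbabilityMeasure ((κ l x).withDensity fun y =>
              ENNReal.ofReal (stepDensity m (fun l x => κ l x) X l x y)) :=
              ⟨by rw [withDensity_apply _ MeasurableSet.univ, Measure.restrict_univ, h4.2]⟩
            gcongr
            exact lintegral_rpow_le hRm (hm l) (hm1 l).le
        _ = (nestedNorm m κ (expWeight X) l.castSucc x * tiltedExp m κ X f l.castSucc x) ^ m l := by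
            rw [ENNReal.mul_rpow_of_nonneg _ _ (hm l).le, tiltedExp_castSucc,
              lintegral_withDensity_eq_lintegral_mul _ hWm hRm]
            rfl
  obtain ⟨ω, hω⟩ := (key 0 fun _ => 0).exists
  rwa [Subsingleton.elim (labels z 0 _ ω) default] at hω

end

end

/-! ### From Laplace transforms to Gibbs averages. -/

section

variable {k : ℕ} {𝒳 : Fin k → Type*} {Ω : Type*}
variable [∀ l, MeasurableSpace (𝒳 l)] [MeasurableSpace Ω] {P : Measure Ω} [IsProbabilityMeasure P]
variable {m : Fin k → ℝ} {u : (l : Fin k) → (Fin l → ℕ) → ℕ → Ω → ℝ}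
  {z : (l : Fin k) → (Fin l → ℕ) → ℕ → Ω → 𝒳 l}
variable {κ : (l : Fin k) → Kernel (Prefix 𝒳 l.castSucc) (𝒳 l)} [∀ l, IsMarkovKernel (κ l)]
variable {X : Prefix 𝒳 (Fin.last k) → ℝ}

lemma lintegral_expNeg_mul {c : ℝ≥0∞} (hc0 : c ≠ 0) (hc : c ≠ ∞) :
    ∫⁻ t in Set.Ioi (0 : ℝ), expNeg (ENNReal.ofReal t * c) = c⁻¹ := by
  have hpos : 0 < c.toReal := ENNReal.toReal_pos hc0 hc
  have h1 : ∫⁻ t in Set.Ioi (0 : ℝ), expNeg (ENNReal.ofReal t * c) =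
      ∫⁻ t in Set.Ioi (0 : ℝ), ENNReal.ofReal (Real.exp (-c.toReal * t)) := by
    refine setLIntegral_congr_fun measurableSet_Ioi fun t ht => ?_
    have ht' : 0 < t := ht
    rw [← ENNReal.ofReal_toReal hc, ← ENNReal.ofReal_mul ht'.le, expNeg_ofReal (by positivity),
      ENNReal.ofReal_toReal hc]
    ring_nf
  rw [h1, ← ofReal_integral_eq_lintegral_ofReal (integrableOn_exp_mul_Ioi (by linarith) 0)
    (ae_of_all _ fun _ => (Real.exp_pos _).le), integral_exp_mul_Ioi (by linarith)]
  simp only [mul_zero, Real.exp_zero]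
  rw [neg_div_neg_eq, one_div, ENNReal.ofReal_inv_of_pos hpos, ENNReal.ofReal_toReal hc]

/-- As `s` tends to infinity the transform bounds the probability of `S = 0` from above by `0`; as
`s` tends to zero it bounds that of `S ≠ ∞` from below by `1`. -/
lemma ae_ne_zero_ne_top_of_lintegral_expNeg {S : Ω → ℝ≥0∞} (hS : Measurable S) {K n : ℝ≥0∞} {θ : ℝ}
    (hK0 : K ≠ 0) (hK : K ≠ ∞) (hn0 : n ≠ 0) (hn : n ≠ ∞) (hθ : 0 < θ)
    (h : ∀ s : ℝ≥0∞, ∫⁻ ω, expNeg (s * S ω) ∂P = expNeg (K * (s * n) ^ θ)) :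
    ∀ᵐ ω ∂P, S ω ≠ 0 ∧ S ω ≠ ∞ := by
  have hlim {a : ℝ≥0∞} {v : ℕ → ℝ≥0∞} (hv : Tendsto v atTop (𝓝 a)) :
      Tendsto (fun j => expNeg (K * (v j * n) ^ θ)) atTop (𝓝 (expNeg (K * (a * n) ^ θ))) := by
    refine (expNeg_continuous.tendsto _).comp (ENNReal.Tendsto.const_mul ?_ (Or.inr hK))
    exact ((ENNReal.continuous_rpow_const (y := θ)).tendsto _).comp
      (ENNReal.Tendsto.mul_const hv (Or.inr hn))
  have h0 : P {ω | S ω = 0} = 0 := by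
    have h1 := hlim ENNReal.tendsto_nat_nhds_top
    rw [ENNReal.top_mul hn0, ENNReal.top_rpow_of_pos hθ, ENNReal.mul_top hK0, expNeg_top] at h1
    have hm : MeasurableSet {ω | S ω = 0} := hS (measurableSet_singleton 0)
    refine le_antisymm (ge_of_tendsto' h1 fun j => ?_) zero_le
    rw [← h, ← lintegral_indicator_one hm]
    refine lintegral_mono fun ω => ?_
    by_cases hω : S ω = 0
    · simp [hω, Set.indicator]
    · simp [hω, Set.indicator]
  have htop : 1 ≤ P {ω | S ω ≠ ∞} := by
    have h1 := hlim ENNReal.tendsto_inv_nat_nhds_zero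
    rw [zero_mul, ENNReal.zero_rpow_of_pos hθ, mul_zero, expNeg_zero] at h1
    refine le_of_tendsto' h1 fun j => ?_
    have hm : MeasurableSet {ω | S ω ≠ ∞} := hS (measurableSet_singleton ∞).compl
    rw [← h, ← lintegral_indicator_one hm]
    refine lintegral_mono fun ω => ?_
    by_cases hω : S ω = ∞
    · simp [hω, Set.indicator, ENNReal.mul_top]
    · simpa [hω, Set.indicator] using expNeg_le_one _
  have htop' : ∀ᵐ ω ∂P, S ω ≠ ∞ :=
    (mem_ae_iff_prob_eq_one (hS (measurableSet_singleton ∞).compl)).2 (le_antisymm prob_le_one htop)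
  have h0' : ∀ᵐ ω ∂P, S ω ≠ 0 := by simpa [ae_iff] using h0
  filter_upwards [h0', htop'] with ω h1 h2 using ⟨h1, h2⟩

/-- If multiplying a positive variable by `1 + r D` makes it larger, in the sense of Laplace
transforms, than adding `r T`, then the expectation of `T / S` is at most `D`. -/
lemma lintegral_div_le_of_lintegral_expNeg_le {S T : Ω → ℝ≥0∞} (hS : Measurable S)
    (hT : Measurable T) (hS' : ∀ᵐ ω ∂P, S ω ≠ 0 ∧ S ω ≠ ∞) (hTS : ∀ ω, T ω ≤ S ω) {D : ℝ≥0∞}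
    (hD : D ≠ ∞)
    (h : ∀ s r : ℝ≥0∞, s ≠ 0 → s ≠ ∞ → r ≠ 0 → r ≠ ∞ →
      ∫⁻ ω, expNeg (s * (1 + r * D) * S ω) ∂P ≤ ∫⁻ ω, expNeg (s * (S ω + r * T ω)) ∂P) :
    ∫⁻ ω, T ω / S ω ∂P ≤ D := by
  -- Both sides of the hypothesis are subtracted from `E exp(-s S)` and divided by `s r`.
  have h1 (s r : ℝ≥0∞) (hs0 : s ≠ 0) (hs : s ≠ ∞) (hr0 : r ≠ 0) (hr : r ≠ ∞) :
      ∫⁻ ω, T ω * expNeg (s * ((1 + r) * S ω)) ∂P ≤ D * ∫⁻ ω, S ω * expNeg (s * S ω) ∂P := by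
    have hfin {g : Ω → ℝ≥0∞} : ∫⁻ ω, expNeg (g ω) ∂P ≠ ∞ :=
      ne_top_of_le_ne_top ENNReal.one_ne_top ((lintegral_mono fun _ => expNeg_le_one _).trans
        (by simp))
    have h2 := tsub_le_tsub_left (h s r hs0 hs hr0 hr) (∫⁻ ω, expNeg (s * S ω) ∂P)
    rw [← lintegral_sub (by fun_prop) hfin (ae_of_all _ fun ω => expNeg_antitone (by
        gcongr; exact le_self_add)),
      ← lintegral_sub (by fun_prop) hfin (ae_of_all _ fun ω => expNeg_antitone (by
        gcongr; exact le_mul_of_one_le_right' le_self_add))] at h2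
    have h3 : s * r * ∫⁻ ω, T ω * expNeg (s * ((1 + r) * S ω)) ∂P ≤
        s * r * (D * ∫⁻ ω, S ω * expNeg (s * S ω) ∂P) := by
      rw [← lintegral_const_mul _ (by fun_prop), ← lintegral_const_mul _ (by fun_prop),
        ← lintegral_const_mul _ (by fun_prop)]
      refine le_trans (lintegral_mono fun ω => ?_) (h2.trans (lintegral_mono fun ω => ?_))
      · have e1 : expNeg (s * (S ω + r * T ω)) = expNeg (s * S ω) * expNeg (s * r * T ω) := by
          rw [← expNeg_add]; ring_nf
        -- Using `T ≤ S`, the exponent becomes a multiple of `S` alone, so that the integral over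
        -- `s` is explicit.
        have e2 : expNeg (s * ((1 + r) * S ω)) ≤ expNeg (s * (S ω + r * T ω)) := by
          refine expNeg_antitone ?_
          rw [add_mul, one_mul]
          gcongr
          exact hTS ω
        calc s * r * (T ω * expNeg (s * ((1 + r) * S ω)))
            ≤ s * r * (T ω * expNeg (s * (S ω + r * T ω))) := by gcongr
          _ = expNeg (s * S ω) * (s * r * T ω * expNeg (s * r * T ω)) := by rw [e1]; ring
          _ ≤ expNeg (s * S ω) * (1 - expNeg (s * r * T ω)) := by gcongr; exact mul_expNeg_le _
          _ = expNeg (s * S ω) - expNeg (s * (S ω + r * T ω)) := by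
            rw [e1, ENNReal.mul_sub fun _ _ => expNeg_ne_top _, mul_one]
      · have e1 : expNeg (s * (1 + r * D) * S ω) = expNeg (s * S ω) * expNeg (s * r * D * S ω) := by
          rw [← expNeg_add]; ring_nf
        calc expNeg (s * S ω) - expNeg (s * (1 + r * D) * S ω)
            = expNeg (s * S ω) * (1 - expNeg (s * r * D * S ω)) := by
              rw [e1, ENNReal.mul_sub fun _ _ => expNeg_ne_top _, mul_one]
          _ ≤ expNeg (s * S ω) * (s * r * D * S ω) := by gcongr; exact one_sub_expNeg_le _
          _ = s * r * (D * (S ω * expNeg (s * S ω))) := by ring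
    exact (ENNReal.mul_le_mul_iff_right (mul_ne_zero hs0 hr0) (ENNReal.mul_ne_top hs hr)).1 h3
  -- Integrating over `s` in `(0, ∞)` turns `S exp(-s S)` into `1` and `T exp(-s (1 + r) S)` into `T
  -- / ((1 + r) S)`. The factor `1 + r` disappears in the limit `r → 0`.
  have h2 (r : ℝ≥0∞) (hr0 : r ≠ 0) (hr : r ≠ ∞) : ∫⁻ ω, T ω / S ω ∂P ≤ (1 + r) * D := by
    have h3 : ∫⁻ t in Set.Ioi (0 : ℝ), ∫⁻ ω, T ω * expNeg (ENNReal.ofReal t * ((1 + r) * S ω)) ∂P ≤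
        ∫⁻ t in Set.Ioi (0 : ℝ), D * ∫⁻ ω, S ω * expNeg (ENNReal.ofReal t * S ω) ∂P :=
      setLIntegral_mono' measurableSet_Ioi fun t ht =>
        h1 _ r (by simpa using ht) ENNReal.ofReal_ne_top hr0 hr
    rw [lintegral_const_mul' _ _ hD,
      lintegral_lintegral_swap (f := fun t ω => T ω * expNeg (ENNReal.ofReal t * ((1 + r) * S ω)))
        (by fun_prop),
      lintegral_lintegral_swap (f := fun t ω => S ω * expNeg (ENNReal.ofReal t * S ω))
        (by fun_prop)] at h3
    have h1r : 1 + r ≠ 0 := by simp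
    have h1r' : 1 + r ≠ ∞ := by simp [hr]
    have h4 : ∫⁻ ω, (∫⁻ t in Set.Ioi (0 : ℝ), S ω * expNeg (ENNReal.ofReal t * S ω)) ∂P = 1 := by
      rw [← measure_univ (μ := P), ← lintegral_one]
      refine lintegral_congr_ae ?_
      filter_upwards [hS'] with ω hω
      rw [lintegral_const_mul' _ _ hω.2, lintegral_expNeg_mul hω.1 hω.2,
        ENNReal.mul_inv_cancel hω.1 hω.2]
    have h5 : ∫⁻ ω, (∫⁻ t in Set.Ioi (0 : ℝ), T ω * expNeg
        (ENNReal.ofReal t * ((1 + r) * S ω))) ∂P =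
        (1 + r)⁻¹ * ∫⁻ ω, T ω / S ω ∂P := by
      rw [← lintegral_const_mul _ (by fun_prop)]
      refine lintegral_congr_ae ?_
      filter_upwards [hS'] with ω hω
      rw [lintegral_const_mul' _ _ (ne_top_of_le_ne_top hω.2 (hTS ω)), lintegral_expNeg_mul
        (mul_ne_zero h1r hω.1) (ENNReal.mul_ne_top h1r' hω.2),
        ENNReal.mul_inv (Or.inl h1r) (Or.inl h1r'), div_eq_mul_inv]
      ring
    rw [h4, h5, mul_one] at h3
    calc ∫⁻ ω, T ω / S ω ∂P = (1 + r) * ((1 + r)⁻¹ * ∫⁻ ω, T ω / S ω ∂P) := by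
          rw [← mul_assoc, ENNReal.mul_inv_cancel h1r h1r', one_mul]
      _ ≤ (1 + r) * D := by gcongr
  have h3 : Tendsto (fun j : ℕ => (1 + ((j : ℝ≥0∞) + 1)⁻¹) * D) atTop (𝓝 ((1 + 0) * D)) := by
    refine ENNReal.Tendsto.mul_const (tendsto_const_nhds.add ?_) (Or.inr hD)
    have := (tendsto_add_atTop_iff_nat 1).2 ENNReal.tendsto_inv_nat_nhds_zero
    simpa using this
  rw [add_zero, one_mul] at h3
  exact ge_of_tendsto' h3 fun j => h2 _ (by simp) (by simp)

/-- Linearity is read off from the expectation along one branch, here the arbitrary branch `fun _ =>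
0`. -/
lemma tiltedExp_one_add (hz : IsTreeProcess P (fun l x => κ l x) z) (hX : Measurable X)
    (hone : tiltedExp m κ X 1 0 default = 1) {f : Prefix 𝒳 (Fin.last k) → ℝ≥0∞}
    (hf : Measurable f) (r : ℝ≥0∞) :
    tiltedExp m κ X (fun x => 1 + r * f x) 0 default = 1 + r * tiltedExp m κ X f 0 default := by
  have hb : Measurable fun ω => ENNReal.ofReal
      (branchDensity m (fun l x => κ l x) X z (fun _ => 0) ω) := by
    simp_rw [← prefixDensity_branch]
    exact (measurable_prefixDensity hX _).comp (measurable_branch hz.measurable _)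
  have hfb := hf.comp (measurable_branch hz.measurable fun _ => 0)
  have h1 := hz.lintegral_branchDensity_mul (m := m) hX measurable_one (fun _ => 0)
  rw [hone] at h1
  have h2 (ω : Ω) : ENNReal.ofReal (branchDensity m (fun l x => κ l x) X z (fun _ => 0) ω) *
      (1 + r * f (branch z (fun _ => 0) ω)) =
      ENNReal.ofReal (branchDensity m (fun l x => κ l x) X z (fun _ => 0) ω) *
        (1 : Prefix 𝒳 (Fin.last k) → ℝ≥0∞) (branch z (fun _ => 0) ω) +
      r * (ENNReal.ofReal (branchDensity m (fun l x => κ l x) X z (fun _ => 0) ω) *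
        f (branch z (fun _ => 0) ω)) := by
    rw [Pi.one_apply]
    ring
  rw [← hz.lintegral_branchDensity_mul hX (by fun_prop) (fun _ => 0),
    ← hz.lintegral_branchDensity_mul hX hf (fun _ => 0)]
  simp_rw [h2]
  exact (lintegral_add_left (hb.mul measurable_const) _).trans
    (congrArg₂ (· + ·) h1 (lintegral_const_mul _ (hb.mul hfb)))

omit [∀ l, MeasurableSpace (𝒳 l)] [MeasurableSpace Ω] in
lemma totalSum_add_mul (w f : Prefix 𝒳 (Fin.last k) → ℝ≥0∞) (r : ℝ≥0∞) (ω : Ω) :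
    totalSum u z (fun x => w x * (1 + r * f x)) ω =
      totalSum u z w ω + r * totalSum u z (fun x => w x * f x) ω := by
  unfold totalSum
  rw [← ENNReal.tsum_mul_left, ← ENNReal.tsum_add]
  exact tsum_congr fun α => by ring

section
variable (hm_mono : StrictMono m) (hm : ∀ l, 0 < m l) (hm1 : ∀ l, m l < 1) (hu : IsCascade P m u)
    (hz : IsTreeProcess P (fun l x => κ l x) z)
    (huz : IndepFun (fun ω l a n => u l a n ω) (fun ω l a n => z l a n ω) P) (hX : Measurable X)
    (hfin : ∀ α, ∫⁻ ω, expWeight X (branch z α ω) ∂P ≠ ∞)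
include hm_mono hm hm1 hu hz huz hX hfin

theorem ae_totalSum_ne : ∀ᵐ ω ∂P, totalSum u z (expWeight X) ω ≠ 0 ∧
    totalSum u z (expWeight X) ω ≠ ∞ := by
  obtain ⟨K, θ, hK0, hK, hθ, h⟩ := exists_lintegral_expNeg_totalSum hm_mono hm hm1 hu hz huz
  have hw := measurable_expWeight hX
  refine ae_ne_zero_ne_top_of_lintegral_expNeg (hu.measurable_totalSum hz.measurable hw) hK0 hK
    (nestedNorm_ne_zero hm hw expWeight_ne_zero _ _) ?_ hθ (h _ hw)
  have h1 := hz.lintegral_nestedNorm_ne_top hm hm1 hw hfin 0 (fun _ => 0)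
  have h2 (ω : Ω) : labels z 0 (fun _ => 0) ω = default := Subsingleton.elim _ _
  simpa only [h2, lintegral_const, measure_univ, mul_one] using h1

/-- The weights `exp X` and `exp X * (1 + r f)` share the constants `K` and `θ`, so the bound
between their norms at the root becomes a bound between transforms. The condition `f ≤ 1` provides
`T ≤ S` and a finite `D`. -/
lemma lintegral_gibbs_le {f : Prefix 𝒳 (Fin.last k) → ℝ≥0∞} (hf : Measurable f)
    (hf1 : ∀ x, f x ≤ 1) :
    ∫⁻ ω, totalSum u z (fun x => expWeight X x * f x) ω / totalSum u z (expWeight X) ω ∂P ≤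
      tiltedExp m κ X f 0 default := by
  have hae := ae_totalSum_ne hm_mono hm hm1 hu hz huz hX hfin
  have hone := hz.tiltedExp_one hm hm1 hX hfin
  obtain ⟨K, θ, hK0, hK, hθ, h⟩ := exists_lintegral_expNeg_totalSum hm_mono hm hm1 hu hz huz
  have hw := measurable_expWeight hX
  have hD : tiltedExp m κ X f 0 default ≤ 1 := by
    rw [← hone, ← hz.lintegral_branchDensity_mul hX hf (fun _ => 0),
      ← hz.lintegral_branchDensity_mul hX measurable_one (fun _ => 0)]
    exact lintegral_mono fun ω => by gcongr; exact hf1 _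
  refine lintegral_div_le_of_lintegral_expNeg_le (S := totalSum u z (expWeight X))
    (T := totalSum u z fun x => expWeight X x * f x) (hu.measurable_totalSum hz.measurable hw)
    (hu.measurable_totalSum hz.measurable (hw.mul hf)) hae (fun ω => ?_)
    (ne_top_of_le_ne_top ENNReal.one_ne_top hD) (fun s r _ _ _ _ => ?_)
  · refine ENNReal.tsum_le_tsum fun α => ?_
    gcongr
    exact mul_le_of_le_one_right' (hf1 _)
  · have e1 (ω) := totalSum_add_mul (u := u) (z := z) (expWeight X) f r ω
    simp only [← e1]
    rw [h _ hw, h _ (by fun_prop)]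
    refine expNeg_antitone ?_
    have h1 := hz.nestedNorm_mul_le hm hm1 hX hfin (f := fun x => 1 + r * f x) (by fun_prop)
    rw [tiltedExp_one_add hz hX hone hf] at h1
    rw [mul_assoc s, mul_comm (1 + _) (nestedNorm _ _ _ _ _)]
    gcongr

/-- The expectation of the Gibbs average of a nonnegative function of the labels. -/
theorem lintegral_gibbs {f : Prefix 𝒳 (Fin.last k) → ℝ≥0∞} (hf : Measurable f) :
    ∫⁻ ω, totalSum u z (fun x => expWeight X x * f x) ω / totalSum u z (expWeight X) ω ∂P =
      tiltedExp m κ X f 0 default := by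
  have hae := ae_totalSum_ne hm_mono hm hm1 hu hz huz hX hfin
  have hone := hz.tiltedExp_one hm hm1 hX hfin
  have hw := measurable_expWeight hX
  have hSm := hu.measurable_totalSum hz.measurable hw
  have hbr := measurable_branch hz.measurable
  have hb : Measurable fun ω => ENNReal.ofReal
      (branchDensity m (fun l x => κ l x) X z (fun _ => 0) ω) := by
    simp_rw [← prefixDensity_branch]
    exact (measurable_prefixDensity hX _).comp (hbr _)
  have hG (α : Fin k → ℕ) : Measurable fun ω => ENNReal.ofReal (weight u α ω) *
      expWeight X (branch z α ω) / totalSum u z (expWeight X) ω :=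
    ((hu.measurable_weight α).ennreal_ofReal.mul (hw.comp (hbr α))).div hSm
  -- `μ` is the law of the labels of a leaf drawn from the random Gibbs weights; `μ'` below is the
  -- law of one branch weighted by its density.
  set μ : Measure (Prefix 𝒳 (Fin.last k)) := Measure.sum fun α : Fin k → ℕ =>
    (P.withDensity fun ω => ENNReal.ofReal (weight u α ω) *
      expWeight X (branch z α ω) / totalSum u z (expWeight X) ω).map (branch z α) with hμ
  set μ' : Measure (Prefix 𝒳 (Fin.last k)) := (P.withDensity fun ω =>
    ENNReal.ofReal (branchDensity m (fun l x => κ l x) X z (fun _ => 0) ω)).map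
      (branch z fun _ => 0) with hμ'
  have e (g : Prefix 𝒳 (Fin.last k) → ℝ≥0∞) (hg : Measurable g) : ∫⁻ x, g x ∂μ =
      ∫⁻ ω, totalSum u z (fun x => expWeight X x * g x) ω / totalSum u z (expWeight X) ω ∂P := by
    have h1 (ω : Ω) : totalSum u z (fun x => expWeight X x * g x) ω / totalSum u z (expWeight X) ω =
        ∑' α, ENNReal.ofReal (weight u α ω) * (expWeight X (branch z α ω) * g (branch z α ω)) *
          (totalSum u z (expWeight X) ω)⁻¹ := by
      rw [div_eq_mul_inv, ENNReal.tsum_mul_right]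
      rfl
    simp_rw [h1]
    have hm (α) : Measurable fun ω => ENNReal.ofReal (weight u α ω) *
        (expWeight X (branch z α ω) * g (branch z α ω)) * (totalSum u z (expWeight X) ω)⁻¹ :=
      ((hu.measurable_weight α).ennreal_ofReal.mul
        ((hw.comp (hbr α)).mul (hg.comp (hbr α)))).mul hSm.inv
    rw [hμ, lintegral_sum_measure, lintegral_tsum fun α => (hm α).aemeasurable]
    refine tsum_congr fun α => ?_
    rw [lintegral_map hg (hbr α)]
    refine (lintegral_withDensity_eq_lintegral_mul _ (hG α) (hg.comp (hbr α))).trans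
      (lintegral_congr fun ω => ?_)
    simp only [Pi.mul_apply, Function.comp_apply, div_eq_mul_inv]
    ring
  have e' (g : Prefix 𝒳 (Fin.last k) → ℝ≥0∞) (hg : Measurable g) :
      ∫⁻ x, g x ∂μ' = tiltedExp m κ X g 0 default := by
    rw [← hz.lintegral_branchDensity_mul hX hg (fun _ => 0), hμ', lintegral_map hg (hbr _)]
    exact lintegral_withDensity_eq_lintegral_mul _ hb (hg.comp (hbr _))
  have hle (A : Set (Prefix 𝒳 (Fin.last k))) (hA : MeasurableSet A) : μ A ≤ μ' A := by
    rw [← lintegral_indicator_one hA, ← lintegral_indicator_one hA, e _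
      (measurable_one.indicator hA),
      e' _ (measurable_one.indicator hA)]
    exact lintegral_gibbs_le hm_mono hm hm1 hu hz huz hX hfin (measurable_one.indicator hA)
      (fun x => Set.indicator_le_self' (by simp) x)
  have hμ1 : μ Set.univ = 1 := by
    have h1 := e 1 measurable_one
    simp only [Pi.one_apply, lintegral_one, mul_one] at h1
    rw [h1, ← measure_univ (μ := P), ← lintegral_one]
    refine lintegral_congr_ae ?_
    filter_upwards [hae] with ω hω
    exact ENNReal.div_self hω.1 hω.2
  have hμ1' : μ' Set.univ = 1 := by
    rw [← lintegral_one]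
    exact (e' _ measurable_one).trans hone
  have : IsProbabilityMeasure μ := ⟨hμ1⟩
  -- Domination together with equal finite mass forces equality, so the one-sided bound is enough.
  have hμμ' : μ = μ' := Measure.eq_of_le_of_measure_univ_eq (Measure.le_iff.2 hle)
    (hμ1.trans hμ1'.symm)
  rw [← e f hf, ← e' f hf, hμμ']

end

end

/-! ### Passing from integrals in `[0, ∞]` to signed functions. -/

section

/-- Meant for `A` and `B` coming from the positive and negative parts of `Y`, whose expectations are
already known in `[0, ∞]`. -/
lemma integrable_and_integral_eq_of_lintegral {Ω : Type*} [MeasurableSpace Ω] {P : Measure Ω}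
    {g : Ω → ℝ} {A B : Ω → ℝ≥0∞} (hA : AEMeasurable A P) (hB : AEMeasurable B P) {a b : ℝ≥0∞}
    (hAa : ∫⁻ ω, A ω ∂P = a) (hBb : ∫⁻ ω, B ω ∂P = b) (ha : a ≠ ∞) (hb : b ≠ ∞)
    (h : ∀ᵐ ω ∂P, g ω = (A ω).toReal - (B ω).toReal) :
    Integrable g P ∧ ∫ ω, g ω ∂P = a.toReal - b.toReal := by
  subst hAa hBb
  have hA' := integrable_toReal_of_lintegral_ne_top hA ha
  have hB' := integrable_toReal_of_lintegral_ne_top hB hb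
  refine ⟨(hA'.sub hB').congr (h.mono fun ω hω => hω.symm), ?_⟩
  rw [integral_congr_ae h, integral_sub hA' hB', integral_toReal hA (ae_lt_top' hA ha),
    integral_toReal hB (ae_lt_top' hB hb)]

lemma toReal_ofReal_sub_toReal_ofReal_neg (x : ℝ) :
    (ENNReal.ofReal x).toReal - (ENNReal.ofReal (-x)).toReal = x := by
  rcases le_total 0 x with h | h
  · rw [ENNReal.toReal_ofReal h, ENNReal.ofReal_of_nonpos (by linarith)]
    simp
  · rw [ENNReal.toReal_ofReal (by linarith : 0 ≤ -x), ENNReal.ofReal_of_nonpos h]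
    simp

lemma summable_and_tsum_eq_toReal {ι : Type*} {a : ι → ℝ} (ha : ∀ i, 0 ≤ a i)
    (h : ∑' i, ENNReal.ofReal (a i) ≠ ∞) :
    Summable a ∧ ∑' i, a i = (∑' i, ENNReal.ofReal (a i)).toReal := by
  have h1 (i : ι) : (ENNReal.ofReal (a i)).toReal = a i := ENNReal.toReal_ofReal (ha i)
  refine ⟨by simpa only [h1] using ENNReal.summable_toReal h, ?_⟩
  rw [ENNReal.tsum_toReal_eq fun _ => ENNReal.ofReal_ne_top]
  simp only [h1]

lemma summable_mul_and_tsum_mul_eq {ι : Type*} {a y : ι → ℝ}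
    (hp : ∑' i, ENNReal.ofReal (a i * y i) ≠ ∞) (hn : ∑' i, ENNReal.ofReal (a i * -y i) ≠ ∞) :
    Summable (fun i => a i * y i) ∧ ∑' i, a i * y i =
      (∑' i, ENNReal.ofReal (a i * y i)).toReal - (∑' i, ENNReal.ofReal (a i * -y i)).toReal := by
  have e (i : ι) : a i * y i =
      (ENNReal.ofReal (a i * y i)).toReal - (ENNReal.ofReal (a i * -y i)).toReal := by
    rw [mul_neg, toReal_ofReal_sub_toReal_ofReal_neg]
  have hp' := ENNReal.summable_toReal hp
  have hn' := ENNReal.summable_toReal hn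
  refine ⟨by simpa only [← e] using hp'.sub hn', ?_⟩
  rw [tsum_congr e, hp'.tsum_sub hn', ENNReal.tsum_toReal_eq fun _ => ENNReal.ofReal_ne_top,
    ENNReal.tsum_toReal_eq fun _ => ENNReal.ofReal_ne_top]

lemma weight_nonneg {k : ℕ} {Ω : Type*} {u : (l : Fin k) → (Fin l → ℕ) → ℕ → Ω → ℝ} {ω : Ω}
    (h : ∀ l a n, 0 < u l a n ω) (α : Fin k → ℕ) : 0 ≤ weight u α ω :=
  Finset.prod_nonneg fun _ _ => (h _ _ _).le

section
variable {k : ℕ} {𝒳 : Fin k → Type*} {Ω : Type*} {u : (l : Fin k) → (Fin l → ℕ) → ℕ → Ω → ℝ}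
  {z : (l : Fin k) → (Fin l → ℕ) → ℕ → Ω → 𝒳 l}

lemma totalSum_expWeight (X : Prefix 𝒳 (Fin.last k) → ℝ) (ω : Ω) :
    totalSum u z (expWeight X) ω =
      ∑' α, ENNReal.ofReal (weight u α ω * Real.exp (X (branch z α ω))) :=
  tsum_congr fun _ => (ENNReal.ofReal_mul' (Real.exp_pos _).le).symm

lemma totalSum_expWeight_mul (X Y : Prefix 𝒳 (Fin.last k) → ℝ) {ω : Ω}
    (h : ∀ l a n, 0 < u l a n ω) :
    totalSum u z (fun x => expWeight X x * ENNReal.ofReal (Y x)) ω =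
      ∑' α, ENNReal.ofReal (weight u α ω * Real.exp (X (branch z α ω)) * Y (branch z α ω)) :=
  tsum_congr fun α => by
    rw [ENNReal.ofReal_mul (mul_nonneg (weight_nonneg h α) (Real.exp_pos _).le),
      ENNReal.ofReal_mul (weight_nonneg h α), mul_assoc]
    rfl

lemma branchDensity_nonneg [∀ l, MeasurableSpace (𝒳 l)] (m : Fin k → ℝ)
    (ν : (l : Fin k) → Prefix 𝒳 l.castSucc → Measure (𝒳 l)) (X : Prefix 𝒳 (Fin.last k) → ℝ)
    (α : Fin k → ℕ) (ω : Ω) : 0 ≤ branchDensity m ν X z α ω :=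
  Finset.prod_nonneg fun _ _ => (Real.exp_pos _).le

end

end

end RuelleCascade

/-! ### The theorem. -/

open RuelleCascade
theorem mainTheorem6 {k : ℕ} {𝒳 : Fin k → Type*} [∀ l, TopologicalSpace (𝒳 l)]
    [∀ l, PolishSpace (𝒳 l)] [∀ l, MeasurableSpace (𝒳 l)] [∀ l, BorelSpace (𝒳 l)]
    (m : Fin k → ℝ) (hm_mono : StrictMono m) (hm_pos : ∀ l, 0 < m l) (hm_lt : ∀ l, m l < 1)
    (ν : (l : Fin k) → Kernel (Prefix 𝒳 l.castSucc) (𝒳 l)) [∀ l, IsMarkovKernel (ν l)]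
    {Ω : Type*} [MeasurableSpace Ω] (P : Measure Ω) [IsProbabilityMeasure P]
    (u : (l : Fin k) → (Fin l → ℕ) → ℕ → Ω → ℝ) (hu : IsCascade P m u)
    (z : (l : Fin k) → (Fin l → ℕ) → ℕ → Ω → 𝒳 l) (hz : IsTreeProcess P (fun l x => ν l x) z)
    (huz : IndepFun (fun ω l a n => u l a n ω) (fun ω l a n => z l a n ω) P)
    (X : Prefix 𝒳 (Fin.last k) → ℝ) (hX : Measurable X)
    (hX_exp : ∀ α, Integrable (fun ω => Real.exp (X (branch z α ω))) P)
    (Y : Prefix 𝒳 (Fin.last k) → ℝ) (hY : Measurable Y)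
    (hY_sq : ∀ α, MemLp (fun ω => Y (branch z α ω)) 2 P) :
    -- the Gibbs weights are well defined
    (∀ᵐ ω ∂P, Summable (fun α => weight u α ω * Real.exp (X (branch z α ω))) ∧
      0 < ∑' α, weight u α ω * Real.exp (X (branch z α ω))) ∧
    ∀ α₀ : Fin k → ℕ,
      -- the identity in `[0, ∞]`, for `|Y|`
      (∫⁻ ω, (∑' α, ENNReal.ofReal
            (weight u α ω * Real.exp (X (branch z α ω)) * |Y (branch z α ω)|)) /
          (∑' α, ENNReal.ofReal (weight u α ω * Real.exp (X (branch z α ω)))) ∂P =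
        ∫⁻ ω, ENNReal.ofReal
          (branchDensity m (fun l x => ν l x) X z α₀ ω * |Y (branch z α₀ ω)|) ∂P) ∧
      -- the identity for `Y`, as soon as its right-hand side exists
      (Integrable (fun ω =>
          branchDensity m (fun l x => ν l x) X z α₀ ω * Y (branch z α₀ ω)) P →
        (∀ᵐ ω ∂P, Summable fun α =>
          weight u α ω * Real.exp (X (branch z α ω)) * Y (branch z α ω)) ∧
        Integrable (fun ω =>
          (∑' α, weight u α ω * Real.exp (X (branch z α ω)) * Y (branch z α ω)) /
            ∑' α, weight u α ω * Real.exp (X (branch z α ω))) P ∧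
        ∫ ω, (∑' α, weight u α ω * Real.exp (X (branch z α ω)) * Y (branch z α ω)) /
            (∑' α, weight u α ω * Real.exp (X (branch z α ω))) ∂P =
          ∫ ω, branchDensity m (fun l x => ν l x) X z α₀ ω * Y (branch z α₀ ω) ∂P) ∧
      -- the right-hand side is the expectation of `Y` under the reweighted law
      (∀ {Ω' : Type*} [MeasurableSpace Ω'] (P' : Measure Ω') [IsProbabilityMeasure P']
          (z' : (l : Fin k) → (Fin l → ℕ) → ℕ → Ω' → 𝒳 l),
        IsTreeProcess P' (reweighted m (fun l x => ν l x) X) z' →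
        (∫⁻ ω, ENNReal.ofReal
            (branchDensity m (fun l x => ν l x) X z α₀ ω * |Y (branch z α₀ ω)|) ∂P =
          ∫⁻ ω', ENNReal.ofReal |Y (branch z' α₀ ω')| ∂P') ∧
        (Integrable (fun ω =>
            branchDensity m (fun l x => ν l x) X z α₀ ω * Y (branch z α₀ ω)) P →
          Integrable (fun ω' => Y (branch z' α₀ ω')) P' ∧
          ∫ ω, branchDensity m (fun l x => ν l x) X z α₀ ω * Y (branch z α₀ ω) ∂P =
            ∫ ω', Y (branch z' α₀ ω') ∂P')) := by
  have hfin (α : Fin k → ℕ) : ∫⁻ ω, expWeight X (branch z α ω) ∂P ≠ ⊤ :=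
    (lintegral_ofReal_ne_top_iff_integrable (hX_exp α).1
      (ae_of_all _ fun _ => (Real.exp_pos _).le)).2 (hX_exp α)
  have hS := ae_totalSum_ne hm_mono hm_pos hm_lt hu hz huz hX hfin
  have hpos := hu.pos
  have hw := measurable_expWeight hX
  have hsum : ∀ᵐ ω ∂P, Summable (fun α => weight u α ω * Real.exp (X (branch z α ω))) ∧
      ∑' α, weight u α ω * Real.exp (X (branch z α ω)) = (totalSum u z (expWeight X) ω).toReal := by
    filter_upwards [hS, hpos] with ω hω hp
    rw [totalSum_expWeight] at hω ⊢
    exact summable_and_tsum_eq_toReal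
      (fun α => mul_nonneg (weight_nonneg hp α) (Real.exp_pos _).le) hω.2
  refine ⟨?_, fun α₀ => ?_⟩
  · filter_upwards [hS, hsum] with ω hω hs
    exact ⟨hs.1, hs.2 ▸ ENNReal.toReal_pos hω.1 hω.2⟩
  have hdens (f : Prefix 𝒳 (Fin.last k) → ℝ) (hf : Measurable f) :
      ∫⁻ ω, ENNReal.ofReal (branchDensity m (fun l x => ν l x) X z α₀ ω * f (branch z α₀ ω)) ∂P =
        tiltedExp m ν X (fun x => ENNReal.ofReal (f x)) 0 default := by
    rw [← hz.lintegral_branchDensity_mul hX hf.ennreal_ofReal α₀]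
    exact lintegral_congr fun ω => ENNReal.ofReal_mul (branchDensity_nonneg _ _ _ _ _)
  have hgibbs (f : Prefix 𝒳 (Fin.last k) → ℝ) (hf : Measurable f) :=
    lintegral_gibbs hm_mono hm_pos hm_lt hu hz huz hX hfin hf.ennreal_ofReal
  have hne (hint : Integrable (fun ω =>
      branchDensity m (fun l x => ν l x) X z α₀ ω * Y (branch z α₀ ω)) P) :
      tiltedExp m ν X (fun x => ENNReal.ofReal |Y x|) 0 default ≠ ⊤ ∧
      tiltedExp m ν X (fun x => ENNReal.ofReal (Y x)) 0 default ≠ ⊤ ∧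
      tiltedExp m ν X (fun x => ENNReal.ofReal (-Y x)) 0 default ≠ ⊤ := by
    have h1 := hint.abs.lintegral_lt_top.ne
    simp only [abs_mul, abs_of_nonneg (branchDensity_nonneg _ _ _ _ _)] at h1
    have h2 (f : Prefix 𝒳 (Fin.last k) → ℝ) (hf : Measurable f) (hfY : ∀ x, f x ≤ |Y x|) :
        tiltedExp m ν X (fun x => ENNReal.ofReal (f x)) 0 default ≠ ⊤ := by
      rw [← hdens f hf]
      refine ne_top_of_le_ne_top h1 (lintegral_mono fun ω => ENNReal.ofReal_le_ofReal ?_)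
      exact mul_le_mul_of_nonneg_left (hfY _) (branchDensity_nonneg _ _ _ _ _)
    exact ⟨h2 _ hY.abs fun _ => le_rfl, h2 _ hY fun _ => le_abs_self _,
      h2 _ hY.neg fun _ => neg_le_abs _⟩
  have hright (hint : Integrable (fun ω =>
      branchDensity m (fun l x => ν l x) X z α₀ ω * Y (branch z α₀ ω)) P) :
      ∫ ω, branchDensity m (fun l x => ν l x) X z α₀ ω * Y (branch z α₀ ω) ∂P =
        (tiltedExp m ν X (fun x => ENNReal.ofReal (Y x)) 0 default).toReal -
          (tiltedExp m ν X (fun x => ENNReal.ofReal (-Y x)) 0 default).toReal := by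
    refine (integrable_and_integral_eq_of_lintegral hint.1.aemeasurable.ennreal_ofReal
      hint.1.aemeasurable.neg.ennreal_ofReal (hdens Y hY) ?_ (hne hint).2.1 (hne hint).2.2
      (ae_of_all _ fun ω => (toReal_ofReal_sub_toReal_ofReal_neg _).symm)).2
    rw [← hdens (fun x => -Y x) hY.neg]
    simp only [Pi.neg_apply, mul_neg]
  refine ⟨?_, fun hint => ?_, ?_⟩
  · rw [hdens _ hY.abs, ← hgibbs _ hY.abs]
    refine lintegral_congr_ae ?_
    filter_upwards [hpos] with ω hp
    rw [totalSum_expWeight_mul X (fun x => |Y x|) hp, totalSum_expWeight]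
  · have hT (f : Prefix 𝒳 (Fin.last k) → ℝ) (hf : Measurable f) :
        Measurable (totalSum u z fun x => expWeight X x * ENNReal.ofReal (f x)) :=
      hu.measurable_totalSum hz.measurable (hw.mul hf.ennreal_ofReal)
    have hSm := hu.measurable_totalSum hz.measurable hw
    -- A Gibbs average of finite expectation is almost surely finite. As its denominator is finite,
    -- an infinite numerator is excluded, and the positive and negative parts of the series
    -- converge.
    have hTfin (f : Prefix 𝒳 (Fin.last k) → ℝ) (hf : Measurable f)
        (h : tiltedExp m ν X (fun x => ENNReal.ofReal (f x)) 0 default ≠ ⊤) : ∀ᵐ ω ∂P,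
        ∑' α, ENNReal.ofReal
          (weight u α ω * Real.exp (X (branch z α ω)) * f (branch z α ω)) ≠ ⊤ := by
      rw [← hgibbs f hf] at h
      filter_upwards [ae_lt_top ((hT f hf).div hSm) h, hS, hpos] with ω h1 h2 h3
      rw [← totalSum_expWeight_mul X f h3]
      refine fun h4 => h1.ne ?_
      rw [Pi.div_apply, h4]
      exact ENNReal.top_div_of_ne_top h2.2
    have hsumY : ∀ᵐ ω ∂P,
        Summable (fun α => weight u α ω * Real.exp (X (branch z α ω)) * Y (branch z α ω)) ∧
        (∑' α, weight u α ω * Real.exp (X (branch z α ω)) * Y (branch z α ω)) /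
            (∑' α, weight u α ω * Real.exp (X (branch z α ω))) =
          (totalSum u z (fun x => expWeight X x * ENNReal.ofReal (Y x)) ω /
            totalSum u z (expWeight X) ω).toReal -
          (totalSum u z (fun x => expWeight X x * ENNReal.ofReal (-Y x)) ω /
            totalSum u z (expWeight X) ω).toReal := by
      filter_upwards [hpos, hsum, hTfin Y hY (hne hint).2.1,
        hTfin (fun x => -Y x) hY.neg (hne hint).2.2] with ω h1 h2 h3 h4
      have h5 := summable_mul_and_tsum_mul_eq h3 h4
      refine ⟨h5.1, ?_⟩
      rw [h5.2, h2.2, totalSum_expWeight_mul X Y h1, totalSum_expWeight_mul X (fun x => -Y x) h1,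
        ENNReal.toReal_div, ENNReal.toReal_div, sub_div]
    have h1 := integrable_and_integral_eq_of_lintegral ((hT Y hY).div hSm).aemeasurable
      ((hT (fun x => -Y x) hY.neg).div hSm).aemeasurable (hgibbs Y hY) (hgibbs _ hY.neg)
      (hne hint).2.1 (hne hint).2.2 (hsumY.mono fun ω h => h.2)
    exact ⟨hsumY.mono fun ω h => h.1, h1.1, h1.2.trans (hright hint).symm⟩
  · intro Ω' _ P' _ z' hz'
    have hb' := measurable_branch hz'.measurable α₀
    refine ⟨?_, fun hint => ?_⟩
    · rw [hdens _ hY.abs, hz'.lintegral_branch_reweighted hX hY.abs.ennreal_ofReal α₀]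
    · rw [hright hint]
      have h1 := integrable_and_integral_eq_of_lintegral (hY.comp hb').ennreal_ofReal.aemeasurable
        (hY.neg.comp hb').ennreal_ofReal.aemeasurable
        (hz'.lintegral_branch_reweighted hX hY.ennreal_ofReal α₀)
        (hz'.lintegral_branch_reweighted hX hY.neg.ennreal_ofReal α₀) (hne hint).2.1 (hne hint).2.2
        (ae_of_all _ fun ω => (toReal_ofReal_sub_toReal_ofReal_neg _).symm)
      exact ⟨h1.1, h1.2.symm⟩
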